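/- Let $d\ge 1$, $\psi(x)=1/(1+|x|^{d+1})$ for $x\in\mathbb R^d$. A configuration $\gamma$ is a locally finite unordered system of points of $\mathbb R^d$, multiple points being allowed; sums over $\gamma$ count multiplicities. Let $\Gamma_*$ be the set of all configurations with $\Psi(\gamma):=\sum_{x\in\gamma}\psi(x)<\infty$, with the weakest topology making all maps $\gamma\mapsto\sum_{x\in\gamma}g(x)\psi(x)$, $g\in C_b(\mathbb R^d)$, continuous, and with its Borel $\sigma$-field; $\mathcal P(\Gamma_*)$ is the set of probability measures on $\Gamma_*$. For $\mu\in\mathcal P(\Gamma_*)$ and $n\ge1$, the correlation measure $\chi^{(n)}_\mu$ on $(\mathbb R^d)^n$ is given by $$\chi_\mu^{(n)}(f)=\int_{\Gamma_*}\sum_{x_1\in\gamma}\ \sum_{x_2\in\gamma\setminus x_1}\cdots\sum_{x_n\in\gamma\setminus\{x_1,\dots,x_{n-1}\}}f(x_1,\dots,x_n)\,\mu(d\gamma),\qquad f\ge 0 \text{ measurable}.$$ $\mathcal P_{\rm exp}$ is the set of all $\mu\in\mathcal P(\Gamma_*)$ whose correlation measures are finite on compact sets and for which there is $\varkappa>0$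 such that $\chi_\mu^{(n)}(\theta^{\otimes n})\le\varkappa^n\|\theta\|_{L^1}^n$ for all $n\ge 1$ and all continuous compactly supported $\theta$. The type of $\mu$ is the least $\varkappa\ge 0$ such that every $\chi^{(n)}_\mu$, $n\ge1$, has a Lebesgue density $k^{(n)}_\mu$ with $0\le k_\mu^{(n)}\le\varkappa^n$ almost everywhere. For $\vartheta\in\mathbb R$, $\mathcal P_{\rm exp}^\vartheta$ is the set of all $\mu\in\mathcal P_{\rm exp}$ of type at most $e^\vartheta$. Let $a,\phi:\mathbb R^d\to[0,\infty)$ be measurable, bounded and integrable, with $\int a(x)\,dx=1$ and $\int|x|^l a(x)\,dx<\infty$ for $l=1,\dots,d+1$, and let $$(LF)(\gamma)=\sum_{x\in\gamma}\int_{\mathbb R^d}a(x-y)\exp\Big(-\sum_{z\in\gamma\setminus x}\phi(z-y)\Big)\big[F(\gamma\setminus x\cup y)-F(\gamma)\big]\,dy$$ (with $e^{-\infty}=0$). Let $\widehat{\mathcal F}$ be the set of all functions $$\widehat F_\tau^{\theta_1,\dots,\theta_m}(\gamma)=\sum_{x_1\in\gamma}\theta_1(x_1)\sum_{x_2\in\gamma\setminus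 x_1}\theta_2(x_2)\cdots\sum_{x_m\in\gamma\setminus\{x_1,\dots,x_{m-1}\}}\theta_m(x_m)\,e^{-\tau\Psi(\gamma\setminus\{x_1,\dots,x_m\})},$$ where $\tau>0$, $m\ge1$, and each $\theta_j$ is strictly positive and of the form $g\psi$ with $g\in C_b(\mathbb R^d)$. Then for all $\vartheta_0\in\mathbb R$ and $T>0$ there is $\vartheta_T\in\mathbb R$ (depending, for the given model, only on $\vartheta_0$ and $T$) such that the following holds. Let $[0,\infty)\ni t\mapsto\mu_t\in\mathcal P(\Gamma_*)$ be measurable (that is, $t\mapsto\mu_t(A)$ is measurable for each Borel $A$), let $\mu_0\in\mathcal P_{\rm exp}^{\vartheta_0}$, and suppose that, for each $F$ in the linear span of $\widehat{\mathcal F}$ and all $t_2>t_1\ge0$, $$\mu_{t_2}(F)=\mu_{t_1}(F)+\int_{t_1}^{t_2}\mu_u(LF)\,du .$$ Then for every $t\in[0,T]$ one has $\mu_t\in\mathcal P_{\rm exp}^{\vartheta_t}$ with some $\vartheta_t<\vartheta_T$. -/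

import Mathlib

open MeasureTheory Set
open scoped ENNReal NNReal BoundedContinuousFunction

noncomputable section

namespace Kawasaki

/-- The physical space `ℝ^d` with its Euclidean norm and Lebesgue measure. -/
abbrev Space (d : ℕ) : Type := EuclideanSpace ℝ (Fin d)

/-! ### Configurations -/

/-- A configuration: a locally finite unordered system of points of `ℝ^d` in which several points
may share a location. `mult x` is the number of points located at `x`. -/
@[ext]
structure Configuration (d : ℕ) where
  mult : Space d → ℕ
  locallyFinite : ∀ K : Set (Space d), IsCompact K → {x | x ∈ K ∧ mult x ≠ 0}.Finite

namespace Configuration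

variable {d : ℕ}

/-- `γ ∖ x`: one of the points of `γ` located at `x` is removed (if there is one). -/
def erase (γ : Configuration d) (x : Space d) : Configuration d where
  mult := Function.update γ.mult x (γ.mult x - 1)
  locallyFinite K hK := by
    refine (γ.locallyFinite K hK).subset ?_
    rintro z ⟨hz, hne⟩
    refine ⟨hz, fun h0 => hne ?_⟩
    by_cases hzx : z = x
    · subst hzx
      simp [h0]
    · simp [Function.update_of_ne hzx, h0]

/-- `γ ∪ y`: one point located at `y` is added. -/
def insert (γ : Configuration d) (y : Space d) : Configuration d where
  mult := Function.update γ.mult y (γ.mult y + 1)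
  locallyFinite K hK := by
    refine ((γ.locallyFinite K hK).insert y).subset ?_
    rintro z ⟨hz, hne⟩
    by_cases hzy : z = y
    · exact Or.inl hzy
    · refine Or.inr ⟨hz, ?_⟩
      simpa [Function.update_of_ne hzy] using hne

end Configuration

/-- The weight `ψ(x) = 1 / (1 + |x|^(d+1))`. -/
def psi {d : ℕ} (x : Space d) : ℝ := 1 / (1 + ‖x‖ ^ (d + 1))

/-- Tempered configurations `Γ_*`: those with `Ψ(γ) = ∑_{x ∈ γ} ψ(x) < ∞`. -/
def Tempered (d : ℕ) : Type :=
  {γ : Configuration d // Summable fun x => (γ.mult x : ℝ) * psi x}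

namespace Tempered

variable {d : ℕ}

/-- The number of points of `γ` located at `x`. -/
def mult (γ : Tempered d) (x : Space d) : ℕ := γ.1.mult x

theorem summable_update (γ : Tempered d) (x : Space d) (n : ℕ) :
    Summable fun z => ((Function.update γ.1.mult x n z : ℕ) : ℝ) * psi z := by
  have h : (fun z => ((Function.update γ.1.mult x n z : ℕ) : ℝ) * psi z)
      = Function.update (fun z => (γ.1.mult z : ℝ) * psi z) x ((n : ℝ) * psi x) := by
    funext z
    by_cases hz : z = x
    · subst hz
      simp
    · simp [Function.update_of_ne hz]
  rw [h]
  exact γ.2.update x _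

/-- `γ ∖ x` for tempered configurations. -/
def erase (γ : Tempered d) (x : Space d) : Tempered d := ⟨γ.1.erase x, γ.summable_update x _⟩

/-- `γ ∪ y` for tempered configurations. -/
def insert (γ : Tempered d) (y : Space d) : Tempered d := ⟨γ.1.insert y, γ.summable_update y _⟩

/-- `∑_{x ∈ γ} g(x)`, each location being counted with its multiplicity. -/
def sum (γ : Tempered d) (g : Space d → ℝ) : ℝ := ∑' x, (γ.mult x : ℝ) * g x

/-- `Ψ(γ) = ∑_{x ∈ γ} ψ(x)`. -/
def Psi (γ : Tempered d) : ℝ := γ.sum psi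

/-- The weak topology of `Γ_*`: the weakest topology that makes all the maps
`γ ↦ ∑_{x ∈ γ} g(x) ψ(x)`, `g` bounded and continuous, continuous. -/
instance : TopologicalSpace (Tempered d) :=
  TopologicalSpace.induced (fun γ (g : Space d →ᵇ ℝ) => γ.sum fun x => g x * psi x) inferInstance

/-- The Borel `σ`-field of `Γ_*`. -/
instance : MeasurableSpace (Tempered d) := borel (Tempered d)

instance : BorelSpace (Tempered d) := ⟨rfl⟩

end Tempered

/-! ### Correlation measures and sub-Poissonian measures -/

/-- The measure on `(ℝ^d)^n` given by
`f ↦ ∑_{x₁ ∈ γ} ∑_{x₂ ∈ γ ∖ x₁} ⋯ ∑_{x_n ∈ γ ∖ {x₁, …, x_(n-1)}} f (x₁, …, x_n)`. -/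
def factorialMeasure {d : ℕ} : (n : ℕ) → Tempered d → Measure (Fin n → Space d)
  | 0, _ => Measure.dirac Fin.elim0
  | n + 1, γ => Measure.sum fun x : Space d =>
      (γ.mult x : ℝ≥0∞) •
        (factorialMeasure n (γ.erase x)).map fun v => (Fin.cons x v : Fin (n + 1) → Space d)

/-- The `n`-th correlation measure `χ_μ^(n)` of `μ`: the `μ`-expectation of the above measure. -/
def correlationMeasure {d : ℕ} (μ : Measure (Tempered d)) (n : ℕ) : Measure (Fin n → Space d) :=
  μ.bind (factorialMeasure n)

/-- `μ` has finite correlations: all its correlation measures are finite on compact sets. -/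
def HasFiniteCorrelations {d : ℕ} (μ : Measure (Tempered d)) : Prop :=
  ∀ n : ℕ, ∀ Λ : Set (Space d), IsCompact Λ →
    correlationMeasure μ n (Set.univ.pi fun _ => Λ) < ∞

/-- The set `P_exp` of sub-Poissonian probability measures. -/
def Pexp (d : ℕ) : Set (Measure (Tempered d)) :=
  {μ | IsProbabilityMeasure μ ∧ HasFiniteCorrelations μ ∧
    ∃ ϰ : ℝ, 0 < ϰ ∧ ∀ θ : Space d → ℝ, Continuous θ → HasCompactSupport θ → ∀ n : ℕ, 1 ≤ n →
      ∫ v, (∏ i, θ (v i)) ∂(correlationMeasure μ n) ≤ ϰ ^ n * (∫ x, |θ x|) ^ n}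

/-- For each `n ≥ 1` the `n`-th correlation measure of `μ` has a density `k^(n)` with respect to
Lebesgue measure, and `0 ≤ k^(n) ≤ ϰ^n` almost everywhere. -/
def HasCorrelationBound {d : ℕ} (μ : Measure (Tempered d)) (ϰ : ℝ≥0) : Prop :=
  ∀ n : ℕ, 1 ≤ n → ∃ k : (Fin n → Space d) → ℝ, Measurable k ∧
    (∀ᵐ v, 0 ≤ k v ∧ k v ≤ (ϰ : ℝ) ^ n) ∧
    correlationMeasure μ n = volume.withDensity fun v => ENNReal.ofReal (k v)

/-- The type of `μ`: the least `ϰ` that bounds the correlation functions as above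
(`∞` if there is none). -/
def measureType {d : ℕ} (μ : Measure (Tempered d)) : ℝ≥0∞ :=
  ⨅ (ϰ : ℝ≥0) (_ : HasCorrelationBound μ ϰ), (ϰ : ℝ≥0∞)

/-- `P_exp^ϑ`: the elements of `P_exp` of type at most `e^ϑ`. -/
def PexpLE (d : ℕ) (ϑ : ℝ) : Set (Measure (Tempered d)) :=
  {μ | μ ∈ Pexp d ∧ measureType μ ≤ ENNReal.ofReal (Real.exp ϑ)}

/-! ### Test functions -/

/-- `Θ_ψ^+`: the strictly positive functions of the form `g ψ` with `g` bounded and continuous. -/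
def ThetaPlus (d : ℕ) : Set (Space d → ℝ) :=
  {θ | (∃ g : Space d →ᵇ ℝ, ∀ x, θ x = g x * psi x) ∧ ∀ x, 0 < θ x}

/-- For a list `[θ₁, …, θ_m]`, the function
`γ ↦ ∑_{x₁ ∈ γ} θ₁(x₁) ∑_{x₂ ∈ γ ∖ x₁} θ₂(x₂) ⋯ ∑_{x_m ∈ γ ∖ {x₁, …, x_(m-1)}} θ_m(x_m)
exp (-τ Ψ(γ ∖ {x₁, …, x_m}))`. -/
def FHat {d : ℕ} (τ : ℝ) : List (Space d → ℝ) → Tempered d → ℝ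
  | [], γ => Real.exp (-τ * γ.Psi)
  | θ :: l, γ => γ.sum fun x => θ x * FHat τ l (γ.erase x)

/-- The set of all `FHat τ [θ₁, …, θ_m]` with `τ > 0`, `m ≥ 1` and `θ₁, …, θ_m ∈ Θ_ψ^+`. -/
def FHatSet (d : ℕ) : Set (Tempered d → ℝ) :=
  {F | ∃ (τ : ℝ) (l : List (Space d → ℝ)), 0 < τ ∧ l ≠ [] ∧ (∀ θ ∈ l, θ ∈ ThetaPlus d) ∧
    F = FHat τ l}

/-! ### The model -/

/-- The conditions on the jump kernel `a` and the repulsion potential `φ`. -/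
structure ModelConditions {d : ℕ} (a φ : Space d → ℝ) : Prop where
  measurable_a : Measurable a
  measurable_φ : Measurable φ
  nonneg_a : ∀ x, 0 ≤ a x
  nonneg_φ : ∀ x, 0 ≤ φ x
  bounded_a : BddAbove (Set.range a)
  bounded_φ : BddAbove (Set.range φ)
  integrable_φ : Integrable φ
  integrable_a : Integrable a
  integral_a : ∫ x, a x = 1
  moments_a : ∀ l ∈ Finset.Icc 1 (d + 1), Integrable fun x => ‖x‖ ^ l * a x

/-- `exp (-s)` for `s ∈ [0, ∞]`, with `exp (-∞) = 0`. -/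
def expNeg (s : ℝ≥0∞) : ℝ := if s = ∞ then 0 else Real.exp (-s.toReal)

/-- The jump rate `c(x, y; γ) = a(x - y) exp (-∑_{z ∈ γ ∖ x} φ(z - y))`. The sum of nonnegative
terms may diverge, in which case the rate is `0`. -/
def jumpRate {d : ℕ} (a φ : Space d → ℝ) (x y : Space d) (γ : Tempered d) : ℝ :=
  a (x - y) * expNeg (∑' z, ((γ.erase x).mult z : ℝ≥0∞) * ENNReal.ofReal (φ (z - y)))

/-- The Kolmogorov operator
`(L F)(γ) = ∑_{x ∈ γ} ∫ c(x, y; γ) [F(γ ∖ x ∪ y) - F(γ)] dy`. -/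
def generator {d : ℕ} (a φ : Space d → ℝ) (F : Tempered d → ℝ) (γ : Tempered d) : ℝ :=
  γ.sum fun x => ∫ y, jumpRate a φ x y γ * (F ((γ.erase x).insert y) - F γ)

/-- `t ↦ μ t`, `t ≥ 0`, is a measurable map into the probability measures on `Γ_*` that solves
`μ_{t₂}(F) = μ_{t₁}(F) + ∫_{t₁}^{t₂} μ_u(L F) du`, `t₂ > t₁ ≥ 0`, for all `F ∈ D`. Values of `μ` at
negative times play no role. -/
structure SolvesFokkerPlanck {d : ℕ} (a φ : Space d → ℝ) (D : Set (Tempered d → ℝ))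
    (μ : ℝ → Measure (Tempered d)) : Prop where
  isProbabilityMeasure : ∀ t, 0 ≤ t → IsProbabilityMeasure (μ t)
  measurable : ∀ A : Set (Tempered d), MeasurableSet A →
    Measurable fun t : Set.Ici (0 : ℝ) => μ t A
  equation : ∀ F ∈ D, ∀ t₁ t₂ : ℝ, 0 ≤ t₁ → t₁ < t₂ →
    ∫ γ, F γ ∂(μ t₂) = ∫ γ, F γ ∂(μ t₁) + ∫ u in t₁..t₂, ∫ γ, generator a φ F γ ∂(μ u)

end Kawasaki

end

/-! Write ⟨θ⟩ for the integral of θ and m for the number of functions θ_i. The proof propagates one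
estimate, `HasProductBound`: μ(F̂_τ^{θ_1,…,θ_m}) ≤ ϰ^m ∏⟨θ_i⟩ for all τ > 0.

The repulsion factor lies in [0, 1], so it can be dropped once the negative terms of F(γ∖x∪y) - F(γ)
are discarded. This leaves L F̂_τ^{θ_1,…,θ_m} ≤ τ F̂_τ^{ψ,θ_1,…,θ_m} + ∑_j F̂_τ^{a∗θ_j, the other
θ_i} (`generator_FHat_le`). Averaging θ ↦ a∗θ preserves ⟨θ⟩ and positivity, and multiplies sup |θ|/ψ
by at most a constant C (`jumpConst`), so the right-hand side again consists of test functions.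

Along a solution this is a hierarchy of inequalities in which order m is coupled to order m + 1.
Iterating it N times over a time r gives (`integral_FHat_le_iterated`) a main term ϰ^m ∏⟨θ_i⟩ exp(m
r + τ ϰ ⟨ψ⟩ (e^r - 1)), which solves the majorizing hierarchy exactly, and a remainder coming from
the a priori bound |F̂_τ| ≤ m! (e^τ/τ)^m ∏ sup |θ_i|/ψ. In the remainder the factorials are offset
by the iterated time integrals, and each factor 1/τ by the τ of the generator bound. What remains is
((C + e^τ) r)^N times a binomial coefficient, which vanishes as N → ∞ if r is small. Letting then τ
→ 0 leaves (ϰ e^r)^m ∏⟨θ_i⟩ (`HasProductBound.of_short_time`). The admissible r does not depend on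
ϰ, so the steps concatenate and ϰ becomes ϰ e^t at time t (`HasProductBound.of_solves`).

At τ = 0 the functions F̂ are the integrals of θ_1 ⊗ ⋯ ⊗ θ_m against the factorial measures. Hence
the product bound is equivalent, for ϰ > 0, to χ^(n) ≤ ϰ^n · Lebesgue for n ≥ 1
(`HasCorrelationBound.hasProductBound`, `HasProductBound.hasCorrelationBound`), by passing from
functions to boxes and from boxes to measures. -/

namespace Kawasaki

noncomputable section

variable {d : ℕ}

/-! ### The weight -/

theorem psi_pos (x : Space d) : 0 < psi x := by unfold psi; positivity

theorem psi_le_one (x : Space d) : psi x ≤ 1 := by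
  unfold psi
  rw [div_le_one (by positivity)]
  have : 0 ≤ ‖x‖ ^ (d + 1) := by positivity
  linarith

theorem continuous_psi : Continuous (psi : Space d → ℝ) := by
  unfold psi
  refine continuous_const.div (by fun_prop) fun x => ?_
  positivity

theorem integrable_psi : Integrable (psi : Space d → ℝ) := by
  have h : Integrable fun x : Space d => (2 : ℝ) ^ d * (1 + ‖x‖) ^ (-((d : ℝ) + 1)) := by
    refine (integrable_one_add_norm (μ := volume) ?_).const_mul _
    simp
  refine h.mono' continuous_psi.aestronglyMeasurable (Filter.Eventually.of_forall fun x => ?_)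
  rw [Real.norm_of_nonneg (psi_pos x).le, Real.rpow_neg (by positivity), psi, div_le_iff₀ (by positivity)]
  have h1 : (1 + ‖x‖) ^ ((d : ℝ) + 1) = (1 + ‖x‖) ^ (d + 1) := by
    rw [← Real.rpow_natCast]; push_cast; rfl
  have h2 := add_pow_le (zero_le_one (α := ℝ)) (norm_nonneg x) (d + 1)
  simp only [one_pow, Nat.add_sub_cancel] at h2
  rw [h1, mul_assoc, mul_comm _ (1 + ‖x‖ ^ (d + 1)), ← mul_assoc, ← div_eq_mul_inv,
    one_le_div (by positivity)]
  exact h2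

/-- Convexity in the form (s + t)^(d+1) ≤ 2^d (s^(d+1) + t^(d+1)) gives this polynomial control on
the variation of ψ. It is what lets the moment of order d + 1 of `a` bound a∗ψ by a multiple of ψ.
-/
theorem psi_le_mul_psi (x y : Space d) :
    psi y ≤ 2 ^ d * (1 + ‖x - y‖ ^ (d + 1)) * psi x := by
  unfold psi
  rw [mul_one_div, div_le_div_iff₀ (by positivity) (by positivity), one_mul]
  have h0 : ‖x‖ ≤ ‖y‖ + ‖x - y‖ := by
    simpa [add_comm] using norm_add_le (x - y) y
  have h1 : ‖x‖ ^ (d + 1) ≤ (‖y‖ + ‖x - y‖) ^ (d + 1) := by gcongr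
  have h2 := add_pow_le (norm_nonneg y) (norm_nonneg (x - y)) (d + 1)
  simp only [Nat.add_sub_cancel] at h2
  have h3 : (1 : ℝ) ≤ 2 ^ d := one_le_pow₀ (by norm_num)
  have h4 : 0 ≤ ‖y‖ ^ (d + 1) := by positivity
  have h5 : 0 ≤ ‖x - y‖ ^ (d + 1) := by positivity
  have h6 : 0 ≤ (2 : ℝ) ^ d * (‖x - y‖ ^ (d + 1) * ‖y‖ ^ (d + 1)) := by positivity
  nlinarith

/-! ### Functions dominated by the weight -/

/-- The continuous functions that are bounded by a multiple of `ψ`. -/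
def Theta (d : ℕ) : Set (Space d → ℝ) :=
  {θ | Continuous θ ∧ ∃ c : ℝ, ∀ x, |θ x| ≤ c * psi x}

/-- The weighted supremum norm `sup |θ| / ψ`. -/
def psiNorm (θ : Space d → ℝ) : ℝ := ⨆ x, |θ x| / psi x

theorem psiNorm_nonneg (θ : Space d → ℝ) : 0 ≤ psiNorm θ :=
  Real.iSup_nonneg fun x => div_nonneg (abs_nonneg _) (psi_pos x).le

theorem psiNorm_le {θ : Space d → ℝ} {c : ℝ} (h : ∀ x, |θ x| ≤ c * psi x) : psiNorm θ ≤ c :=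
  ciSup_le fun x => (div_le_iff₀ (psi_pos x)).2 (h x)

theorem abs_le_psiNorm_mul {θ : Space d → ℝ} (hθ : θ ∈ Theta d) (x : Space d) :
    |θ x| ≤ psiNorm θ * psi x := by
  obtain ⟨-, c, hc⟩ := hθ
  rw [← div_le_iff₀ (psi_pos x)]
  refine le_ciSup (f := fun x => |θ x| / psi x) ⟨c, ?_⟩ x
  rintro _ ⟨y, rfl⟩
  exact (div_le_iff₀ (psi_pos y)).2 (hc y)

theorem psi_mem_theta : (psi : Space d → ℝ) ∈ Theta d :=
  ⟨continuous_psi, 1, fun x => by rw [abs_of_pos (psi_pos x), one_mul]⟩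

theorem psiNorm_psi_le : psiNorm (psi : Space d → ℝ) ≤ 1 :=
  psiNorm_le fun x => by rw [abs_of_pos (psi_pos x), one_mul]

theorem integrable_of_mem_theta {θ : Space d → ℝ} (hθ : θ ∈ Theta d) : Integrable θ := by
  obtain ⟨h, c, hc⟩ := hθ
  exact (integrable_psi.const_mul c).mono' h.aestronglyMeasurable (Filter.Eventually.of_forall hc)

theorem bounded_mul_mem_theta {g θ : Space d → ℝ} (hg : Continuous g) {b : ℝ}
    (hb : ∀ x, |g x| ≤ b) (hθ : θ ∈ Theta d) : (fun x => θ x * g x) ∈ Theta d := by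
  refine ⟨hθ.1.mul hg, psiNorm θ * b, fun x => ?_⟩
  rw [abs_mul]
  calc |θ x| * |g x| ≤ (psiNorm θ * psi x) * b :=
        mul_le_mul (abs_le_psiNorm_mul hθ x) (hb x) (abs_nonneg _)
          (mul_nonneg (psiNorm_nonneg _) (psi_pos x).le)
    _ = _ := by ring

theorem abs_le_of_mem_theta {θ : Space d → ℝ} (hθ : θ ∈ Theta d) (x : Space d) :
    |θ x| ≤ psiNorm θ :=
  (abs_le_psiNorm_mul hθ x).trans (mul_le_of_le_one_right (psiNorm_nonneg _) (psi_le_one x))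

theorem mem_theta_iff {θ : Space d → ℝ} :
    θ ∈ Theta d ↔ ∃ g : Space d →ᵇ ℝ, ∀ x, θ x = g x * psi x := by
  constructor
  · intro h
    refine ⟨BoundedContinuousFunction.ofNormedAddCommGroup (fun x => θ x / psi x)
      (h.1.div continuous_psi fun x => (psi_pos x).ne') (psiNorm θ) fun x => ?_, fun x => ?_⟩
    · rw [Real.norm_eq_abs, abs_div, abs_of_pos (psi_pos x), div_le_iff₀ (psi_pos x)]
      exact abs_le_psiNorm_mul h x
    · have := (psi_pos x).ne'
      simp only [BoundedContinuousFunction.coe_ofNormedAddCommGroup]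
      field_simp
  · rintro ⟨g, hg⟩
    have : θ = fun x => g x * psi x := funext hg
    subst this
    refine ⟨g.continuous.mul continuous_psi, ‖g‖, fun x => ?_⟩
    rw [abs_mul, abs_of_pos (psi_pos x)]
    exact mul_le_mul_of_nonneg_right (g.norm_coe_le_norm x) (psi_pos x).le

theorem mem_thetaPlus_iff {θ : Space d → ℝ} :
    θ ∈ ThetaPlus d ↔ θ ∈ Theta d ∧ ∀ x, 0 < θ x := by
  rw [mem_theta_iff]; rfl

theorem psi_mem_thetaPlus : (psi : Space d → ℝ) ∈ ThetaPlus d :=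
  mem_thetaPlus_iff.2 ⟨psi_mem_theta, psi_pos⟩

/-! ### Averaging over the jump kernel -/

/-- `(a ∗ θ)(x) = ∫ a(x - y) θ(y) dy`. -/
def jumpAverage (a θ : Space d → ℝ) (x : Space d) : ℝ := ∫ y, a (x - y) * θ y

/-- A constant `C` such that `a ∗ ψ ≤ C ψ`. -/
def jumpConst (a : Space d → ℝ) : ℝ := 2 ^ d * (1 + ∫ x, ‖x‖ ^ (d + 1) * a x)

theorem jumpAverage_eq (a θ : Space d → ℝ) (x : Space d) :
    jumpAverage a θ x = ∫ z, a z * θ (x - z) := by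
  unfold jumpAverage
  rw [← integral_sub_left_eq_self _ volume x]
  simp

section Model

variable {a φ : Space d → ℝ}

theorem integrable_jump_mul (h : ModelConditions a φ) {θ : Space d → ℝ} (hθ : θ ∈ Theta d)
    (x : Space d) : Integrable fun y => a (x - y) * θ y :=
  (h.integrable_a.comp_sub_left x).mul_bdd (c := psiNorm θ) hθ.1.aestronglyMeasurable
    (Filter.Eventually.of_forall fun y => abs_le_of_mem_theta hθ y)

theorem integral_jump (h : ModelConditions a φ) (x : Space d) : ∫ y, a (x - y) = 1 := by
  rw [integral_sub_left_eq_self _ volume x, h.integral_a]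

theorem integrable_moment (h : ModelConditions a φ) :
    Integrable fun x => ‖x‖ ^ (d + 1) * a x :=
  h.moments_a (d + 1) (by simp)

theorem jumpConst_nonneg (h : ModelConditions a φ) : 0 ≤ jumpConst a := by
  have : 0 ≤ ∫ x, ‖x‖ ^ (d + 1) * a x :=
    integral_nonneg fun x => mul_nonneg (by positivity) (h.nonneg_a x)
  unfold jumpConst
  positivity

theorem jumpAverage_psi_le (h : ModelConditions a φ) (x : Space d) :
    jumpAverage a psi x ≤ jumpConst a * psi x := by
  have h1 : Integrable fun z => a z + ‖z‖ ^ (d + 1) * a z := h.integrable_a.add (integrable_moment h)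
  have h2 : Integrable fun y => a (x - y) + ‖x - y‖ ^ (d + 1) * a (x - y) :=
    h1.comp_sub_left x
  calc jumpAverage a psi x
      ≤ ∫ y, (2 ^ d * psi x) * (a (x - y) + ‖x - y‖ ^ (d + 1) * a (x - y)) := by
        refine integral_mono (integrable_jump_mul h psi_mem_theta x) (h2.const_mul _) fun y => ?_
        have := mul_le_mul_of_nonneg_left (psi_le_mul_psi x y) (h.nonneg_a (x - y))
        dsimp only
        linarith
    _ = jumpConst a * psi x := by
        rw [integral_const_mul,
          integral_sub_left_eq_self (fun z => a z + ‖z‖ ^ (d + 1) * a z) volume x,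
          integral_add h.integrable_a (integrable_moment h), h.integral_a, jumpConst]
        ring

theorem abs_jumpAverage_le (h : ModelConditions a φ) {θ : Space d → ℝ} (hθ : θ ∈ Theta d)
    (x : Space d) : |jumpAverage a θ x| ≤ jumpConst a * psiNorm θ * psi x := by
  calc |jumpAverage a θ x| ≤ ∫ y, psiNorm θ * (a (x - y) * psi y) := by
        rw [← Real.norm_eq_abs]
        refine norm_integral_le_of_norm_le
          ((integrable_jump_mul h psi_mem_theta x).const_mul _)
          (Filter.Eventually.of_forall fun y => ?_)
        rw [Real.norm_eq_abs, abs_mul, abs_of_nonneg (h.nonneg_a _)]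
        have := mul_le_mul_of_nonneg_left (abs_le_psiNorm_mul hθ y) (h.nonneg_a (x - y))
        linarith
    _ = psiNorm θ * jumpAverage a psi x := by rw [integral_const_mul]; rfl
    _ ≤ psiNorm θ * (jumpConst a * psi x) :=
        mul_le_mul_of_nonneg_left (jumpAverage_psi_le h x) (psiNorm_nonneg _)
    _ = _ := by ring

theorem jumpAverage_mem_theta (h : ModelConditions a φ) {θ : Space d → ℝ} (hθ : θ ∈ Theta d) :
    jumpAverage a θ ∈ Theta d := by
  refine ⟨?_, _, abs_jumpAverage_le h hθ⟩
  have : jumpAverage a θ = fun x => ∫ z, a z * θ (x - z) := funext (jumpAverage_eq a θ)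
  rw [this]
  refine continuous_of_dominated (bound := fun z => a z * psiNorm θ) (fun x => ?_) (fun x => ?_)
    (h.integrable_a.mul_const _) ?_
  · exact h.integrable_a.aestronglyMeasurable.mul
      (hθ.1.comp (continuous_const.sub continuous_id)).aestronglyMeasurable
  · refine Filter.Eventually.of_forall fun z => ?_
    rw [Real.norm_eq_abs, abs_mul, abs_of_nonneg (h.nonneg_a _)]
    exact mul_le_mul_of_nonneg_left (abs_le_of_mem_theta hθ _) (h.nonneg_a _)
  · refine Filter.Eventually.of_forall fun z => ?_
    have := hθ.1
    fun_prop

theorem psiNorm_jumpAverage_le (h : ModelConditions a φ) {θ : Space d → ℝ} (hθ : θ ∈ Theta d) :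
    psiNorm (jumpAverage a θ) ≤ jumpConst a * psiNorm θ :=
  psiNorm_le (abs_jumpAverage_le h hθ)

/-- Since `a` has integral 1, y ↦ a(x - y) is nonzero on a set of positive measure, where θ > 0.
Strict positivity matters because the hierarchy must stay within the admissible test functions. -/
theorem jumpAverage_mem_thetaPlus (h : ModelConditions a φ) {θ : Space d → ℝ}
    (hθ : θ ∈ ThetaPlus d) : jumpAverage a θ ∈ ThetaPlus d := by
  rw [mem_thetaPlus_iff] at hθ ⊢
  refine ⟨jumpAverage_mem_theta h hθ.1, fun x => ?_⟩
  unfold jumpAverage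
  rw [integral_pos_iff_support_of_nonneg
    (fun y => mul_nonneg (h.nonneg_a _) (hθ.2 y).le) (integrable_jump_mul h hθ.1 x)]
  have h1 : (Function.support fun y => a (x - y) * θ y) = Function.support fun y => a (x - y) := by
    ext y
    simp [(hθ.2 y).ne']
  rw [h1, ← integral_pos_iff_support_of_nonneg (fun y => h.nonneg_a _)
    (h.integrable_a.comp_sub_left x), integral_jump h]
  exact one_pos

/-- Convolution with a probability density preserves integrals. For this reason C enters only the
remainder of the iteration and not the final growth rate. -/
theorem integral_jumpAverage (h : ModelConditions a φ) {θ : Space d → ℝ} (hθ : θ ∈ Theta d) :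
    ∫ x, jumpAverage a θ x = ∫ x, θ x := by
  have := integral_convolution (ContinuousLinearMap.mul ℝ ℝ) (μ := (volume : Measure (Space d)))
    (ν := (volume : Measure (Space d))) h.integrable_a (integrable_of_mem_theta hθ)
  rw [h.integral_a] at this
  simp only [ContinuousLinearMap.mul_apply', one_mul] at this
  rw [← this]
  refine integral_congr_ae (Filter.Eventually.of_forall fun x => ?_)
  simp only [jumpAverage_eq, convolution_def, ContinuousLinearMap.mul_apply']

end Model

/-! ### Adding and removing points -/

namespace Tempered

theorem ext' {γ γ' : Tempered d} (h : ∀ x, γ.mult x = γ'.mult x) : γ = γ' :=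
  Subtype.ext (Configuration.ext (funext h))

theorem mult_insert (γ : Tempered d) (y x : Space d) :
    (γ.insert y).mult x = Function.update γ.mult y (γ.mult y + 1) x := rfl

theorem mult_erase (γ : Tempered d) (y x : Space d) :
    (γ.erase y).mult x = Function.update γ.mult y (γ.mult y - 1) x := rfl

theorem erase_insert (γ : Tempered d) (y : Space d) : (γ.insert y).erase y = γ := by
  refine ext' fun x => ?_
  by_cases h : x = y
  · subst h; simp [mult_erase, mult_insert]
  · simp [mult_erase, mult_insert, h]

theorem insert_erase {γ : Tempered d} {x : Space d} (hx : γ.mult x ≠ 0) :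
    (γ.erase x).insert x = γ := by
  refine ext' fun z => ?_
  by_cases h : z = x
  · subst h; simp [mult_erase, mult_insert]; omega
  · simp [mult_erase, mult_insert, h]

/-- The hypothesis matters when x = y: at an empty location, removal undoes the insertion on the
left but does nothing on the right. -/
theorem erase_insert_comm {γ : Tempered d} {x : Space d} (hx : γ.mult x ≠ 0) (y : Space d) :
    (γ.insert y).erase x = (γ.erase x).insert y := by
  by_cases h : x = y
  · subst h; rw [erase_insert, insert_erase hx]
  · refine ext' fun z => ?_
    by_cases h1 : z = x
    · subst h1; simp [mult_erase, mult_insert, h]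
    · by_cases h2 : z = y
      · subst h2; simp [mult_erase, mult_insert, h1]
      · simp [mult_erase, mult_insert, h1, h2]

/-! ### Sums over configurations -/

theorem summable_of_le (γ : Tempered d) {g : Space d → ℝ} {c : ℝ}
    (h : ∀ x, γ.mult x ≠ 0 → |g x| ≤ c * psi x) : Summable fun x => (γ.mult x : ℝ) * g x := by
  have hs : Summable fun x => c * ((γ.mult x : ℝ) * psi x) := Summable.mul_left c γ.2
  refine hs.of_norm_bounded fun x => ?_
  rw [Real.norm_eq_abs, abs_mul, Nat.abs_cast]
  by_cases hx : γ.mult x = 0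
  · simp [hx]
  · have := mul_le_mul_of_nonneg_left (h x hx) (Nat.cast_nonneg (α := ℝ) (γ.mult x))
    linarith

theorem sum_congr {γ : Tempered d} {g g' : Space d → ℝ} (h : ∀ x, γ.mult x ≠ 0 → g x = g' x) :
    γ.sum g = γ.sum g' := by
  refine tsum_congr fun x => ?_
  by_cases hx : γ.mult x = 0
  · simp [hx]
  · rw [h x hx]

theorem sum_nonneg {γ : Tempered d} {g : Space d → ℝ} (h : ∀ x, γ.mult x ≠ 0 → 0 ≤ g x) :
    0 ≤ γ.sum g := by
  refine tsum_nonneg fun x => ?_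
  by_cases hx : γ.mult x = 0
  · simp [hx]
  · exact mul_nonneg (Nat.cast_nonneg _) (h x hx)

/-- The left-hand sum need not converge: it then counts as `0`. -/
theorem sum_le_sum {γ : Tempered d} {g g' : Space d → ℝ}
    (hs : Summable fun x => (γ.mult x : ℝ) * g' x) (h : ∀ x, γ.mult x ≠ 0 → g x ≤ g' x)
    (h0 : ∀ x, γ.mult x ≠ 0 → 0 ≤ g' x) : γ.sum g ≤ γ.sum g' := by
  by_cases hg : Summable fun x => (γ.mult x : ℝ) * g x
  · refine hg.tsum_le_tsum (fun x => ?_) hs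
    by_cases hx : γ.mult x = 0
    · simp [hx]
    · exact mul_le_mul_of_nonneg_left (h x hx) (Nat.cast_nonneg _)
  · rw [sum, tsum_eq_zero_of_not_summable hg]
    exact sum_nonneg h0

theorem abs_sum_le {γ : Tempered d} {g : Space d → ℝ} {c : ℝ}
    (h : ∀ x, γ.mult x ≠ 0 → |g x| ≤ c * psi x) : |γ.sum g| ≤ c * γ.Psi := by
  have hs : Summable fun x => c * ((γ.mult x : ℝ) * psi x) := Summable.mul_left c γ.2
  rw [← Real.norm_eq_abs]
  refine (tsum_of_norm_bounded hs.hasSum fun x => ?_).trans_eq tsum_mul_left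
  rw [Real.norm_eq_abs, abs_mul, Nat.abs_cast]
  by_cases hx : γ.mult x = 0
  · simp [hx]
  · have := mul_le_mul_of_nonneg_left (h x hx) (Nat.cast_nonneg (α := ℝ) (γ.mult x))
    linarith

theorem sum_insert {γ : Tempered d} {g : Space d → ℝ} (y : Space d)
    (hs : Summable fun x => (γ.mult x : ℝ) * g x) : (γ.insert y).sum g = γ.sum g + g y := by
  have h : ∀ x, ((γ.insert y).mult x : ℝ) * g x
      = (γ.mult x : ℝ) * g x + if x = y then g y else 0 := by
    intro x
    by_cases hx : x = y
    · subst hx; simp [mult_insert]; ring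
    · simp [mult_insert, hx]
  unfold sum
  rw [tsum_congr h, hs.tsum_add (hasSum_ite_eq y (g y)).summable, tsum_ite_eq]

theorem Psi_insert (γ : Tempered d) (y : Space d) : (γ.insert y).Psi = γ.Psi + psi y :=
  sum_insert y γ.2

theorem Psi_eq_erase_add {γ : Tempered d} {x : Space d} (hx : γ.mult x ≠ 0) :
    γ.Psi = (γ.erase x).Psi + psi x := by
  conv_lhs => rw [← insert_erase hx, Psi_insert]

theorem Psi_nonneg (γ : Tempered d) : 0 ≤ γ.Psi := sum_nonneg fun x _ => (psi_pos x).le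

theorem Psi_erase_le {γ : Tempered d} {x : Space d} (hx : γ.mult x ≠ 0) :
    (γ.erase x).Psi ≤ γ.Psi := by
  rw [Psi_eq_erase_add hx]
  exact le_add_of_nonneg_right (psi_pos x).le

theorem continuous_sum {θ : Space d → ℝ} (h : θ ∈ Theta d) :
    Continuous fun γ : Tempered d => γ.sum θ := by
  obtain ⟨g, hg⟩ := mem_theta_iff.1 h
  have h1 : Continuous fun (γ : Tempered d) (g : Space d →ᵇ ℝ) => γ.sum fun x => g x * psi x :=
    continuous_induced_dom
  convert (continuous_apply g).comp h1 using 1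
  funext γ
  exact congrArg γ.sum (funext hg)

end Tempered

/-! ### Removing one entry of a list -/

/-- All the ways to take one entry out of a list: the entry and the list that remains. -/
def picks {α : Type*} : List α → List (α × List α)
  | [] => []
  | x :: l => (x, l) :: (picks l).map fun p => (p.1, x :: p.2)

theorem perm_of_mem_picks {α : Type*} {l : List α} {p : α × List α} (hp : p ∈ picks l) :
    (p.1 :: p.2).Perm l := by
  induction l generalizing p with
  | nil => simp [picks] at hp
  | cons x l ih =>
    simp only [picks, List.mem_cons, List.mem_map] at hp
    rcases hp with rfl | ⟨q, hq, rfl⟩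
    · exact List.Perm.refl _
    · exact (List.Perm.swap _ _ _).trans ((ih hq).cons x)

theorem length_picks {α : Type*} (l : List α) : (picks l).length = l.length := by
  induction l with
  | nil => rfl
  | cons x l ih => simp [picks, ih]

theorem length_of_mem_picks {α : Type*} {l : List α} {p : α × List α} (hp : p ∈ picks l) :
    p.2.length + 1 = l.length := (perm_of_mem_picks hp).length_eq

theorem forall_of_mem_picks {α : Type*} {P : α → Prop} {l : List α} (hl : ∀ x ∈ l, P x)
    {p : α × List α} (hp : p ∈ picks l) : P p.1 ∧ ∀ x ∈ p.2, P x := by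
  have h := fun x => (perm_of_mem_picks hp).mem_iff (a := x)
  exact ⟨hl _ ((h _).1 (by simp)), fun x hx => hl _ ((h _).1 (by simp [hx]))⟩

/-- Exchange of a finite sum of a list and a sum over a configuration. -/
theorem Tempered.sum_list_sum {ι : Type*} (γ : Tempered d) (L : List ι) (f : ι → Space d → ℝ)
    (hf : ∀ i ∈ L, Summable fun x => (γ.mult x : ℝ) * f i x) :
    (Summable fun x => (γ.mult x : ℝ) * (L.map fun i => f i x).sum) ∧
    γ.sum (fun x => (L.map fun i => f i x).sum) = (L.map fun i => γ.sum (f i)).sum := by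
  induction L with
  | nil => simp [Tempered.sum, summable_zero]
  | cons i L ih =>
    obtain ⟨h1, h2⟩ := ih fun j hj => hf j (by simp [hj])
    have h3 := hf i (by simp)
    simp only [List.map_cons, List.sum_cons]
    constructor
    · simpa only [mul_add] using h3.add h1
    · rw [← h2]
      unfold Tempered.sum
      simp only [mul_add]
      exact h3.tsum_add h1

theorem Tempered.sum_add {γ : Tempered d} {f g : Space d → ℝ}
    (hf : Summable fun x => (γ.mult x : ℝ) * f x) (hg : Summable fun x => (γ.mult x : ℝ) * g x) :
    γ.sum (fun x => f x + g x) = γ.sum f + γ.sum g := by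
  unfold Tempered.sum
  simp only [mul_add]
  exact hf.tsum_add hg

theorem Tempered.sum_mul_const (γ : Tempered d) (f : Space d → ℝ) (c : ℝ) :
    γ.sum (fun x => f x * c) = γ.sum f * c := by
  unfold Tempered.sum
  simp only [← mul_assoc]
  exact tsum_mul_right

/-! ### The test functions -/

section FHat

variable {τ : ℝ} {l : List (Space d → ℝ)}

theorem prod_psiNorm_nonneg (l : List (Space d → ℝ)) : 0 ≤ (l.map psiNorm).prod :=
  List.prod_nonneg fun _ h => by
    obtain ⟨θ, -, rfl⟩ := List.mem_map.1 h
    exact psiNorm_nonneg θ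

/-- The bound for `FHat` in terms of `Ψ`. -/
def FHatBound (τ : ℝ) (l : List (Space d → ℝ)) (γ : Tempered d) : ℝ :=
  (l.map psiNorm).prod * (Real.exp (τ * l.length) * γ.Psi ^ l.length * Real.exp (-τ * γ.Psi))

/-- Removing a point lowers Ψ by ψ(x) ≤ 1, so the exponential changes by a factor of at most e^τ per
removed point. This induction step serves both the bound on `FHat` and the summability of its
defining sum. -/
theorem abs_theta_mul_FHat_le (hτ : 0 ≤ τ) {θ : Space d → ℝ} (hθ : θ ∈ Theta d)
    {γ : Tempered d} {x : Space d} (hx : γ.mult x ≠ 0)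
    (ih : |FHat τ l (γ.erase x)| ≤ FHatBound τ l (γ.erase x)) :
    |θ x * FHat τ l (γ.erase x)| ≤ psiNorm θ * ((l.map psiNorm).prod *
      (Real.exp (τ * (l.length + 1)) * γ.Psi ^ l.length * Real.exp (-τ * γ.Psi))) * psi x := by
  have h0 := Tempered.Psi_nonneg (γ.erase x)
  have h1 : γ.Psi = (γ.erase x).Psi + psi x := Tempered.Psi_eq_erase_add hx
  have h2 : FHatBound τ l (γ.erase x) ≤ (l.map psiNorm).prod *
      (Real.exp (τ * (l.length + 1)) * γ.Psi ^ l.length * Real.exp (-τ * γ.Psi)) := by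
    unfold FHatBound
    refine mul_le_mul_of_nonneg_left ?_ (prod_psiNorm_nonneg l)
    have h3 : (γ.erase x).Psi ^ l.length ≤ γ.Psi ^ l.length := by
      gcongr; exact Tempered.Psi_erase_le hx
    have h4 : Real.exp (τ * l.length) * Real.exp (-τ * (γ.erase x).Psi)
        ≤ Real.exp (τ * (l.length + 1)) * Real.exp (-τ * γ.Psi) := by
      rw [← Real.exp_add, ← Real.exp_add, Real.exp_le_exp, h1]
      have := mul_le_mul_of_nonneg_left (psi_le_one x) hτ
      linarith
    calc _ = (Real.exp (τ * l.length) * Real.exp (-τ * (γ.erase x).Psi))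
          * (γ.erase x).Psi ^ l.length := by ring
      _ ≤ (Real.exp (τ * (l.length + 1)) * Real.exp (-τ * γ.Psi)) * γ.Psi ^ l.length := by gcongr
      _ = _ := by ring
  rw [abs_mul]
  calc |θ x| * |FHat τ l (γ.erase x)| ≤ (psiNorm θ * psi x) * _ :=
        mul_le_mul (abs_le_psiNorm_mul hθ x) (ih.trans h2) (abs_nonneg _)
          (mul_nonneg (psiNorm_nonneg _) (psi_pos x).le)
    _ = _ := by ring

theorem abs_FHat_le_FHatBound (hτ : 0 ≤ τ) (hl : ∀ θ ∈ l, θ ∈ Theta d) (γ : Tempered d) :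
    |FHat τ l γ| ≤ FHatBound τ l γ := by
  induction l generalizing γ with
  | nil => simp [FHat, FHatBound]
  | cons θ l ih =>
    have h := Tempered.abs_sum_le (γ := γ) fun x hx => abs_theta_mul_FHat_le hτ (hl θ (by simp)) hx
      (ih (fun θ' h => hl θ' (by simp [h])) (γ.erase x))
    refine h.trans_eq ?_
    simp only [FHatBound, List.map_cons, List.prod_cons, List.length_cons]
    push_cast
    ring

theorem summable_FHat (hτ : 0 ≤ τ) {θ : Space d → ℝ} (hθ : θ ∈ Theta d)
    (hl : ∀ θ ∈ l, θ ∈ Theta d) (γ : Tempered d) :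
    Summable fun x => (γ.mult x : ℝ) * (θ x * FHat τ l (γ.erase x)) :=
  γ.summable_of_le fun _ hx => abs_theta_mul_FHat_le hτ hθ hx (abs_FHat_le_FHatBound hτ hl _)

theorem FHat_nonneg (hl : ∀ θ ∈ l, ∀ x, 0 ≤ θ x) (γ : Tempered d) : 0 ≤ FHat τ l γ := by
  induction l generalizing γ with
  | nil => exact (Real.exp_pos _).le
  | cons θ l ih =>
    exact Tempered.sum_nonneg fun x _ => mul_nonneg (hl θ (by simp) x)
      (ih (fun θ' h => hl θ' (by simp [h])) _)

theorem FHat_antitone {τ' : ℝ} (hτ : 0 ≤ τ) (hττ' : τ ≤ τ') (hl : ∀ θ ∈ l, θ ∈ Theta d)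
    (h0 : ∀ θ ∈ l, ∀ x, 0 ≤ θ x) (γ : Tempered d) : FHat τ' l γ ≤ FHat τ l γ := by
  induction l generalizing γ with
  | nil =>
    have := mul_le_mul_of_nonneg_right hττ' γ.Psi_nonneg
    simp only [FHat, Real.exp_le_exp]
    linarith
  | cons θ l ih =>
    have hl' : ∀ θ' ∈ l, θ' ∈ Theta d := fun θ' h => hl θ' (by simp [h])
    have h0' : ∀ θ' ∈ l, ∀ x, 0 ≤ θ' x := fun θ' h => h0 θ' (by simp [h])
    exact Tempered.sum_le_sum (summable_FHat hτ (hl θ (by simp)) hl' γ)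
      (fun x _ => mul_le_mul_of_nonneg_left (ih hl' h0' _) (h0 θ (by simp) x))
      fun x _ => mul_nonneg (h0 θ (by simp) x) (FHat_nonneg h0' _)

/-- The number s stays fixed through the induction, because removing points only decreases Ψ. With s
= Ψ(γ) the left side tends to `FHat 0 l γ` as τ → 0, which is how the exponential damping is removed
later. -/
theorem exp_mul_FHat_zero_le (hτ : 0 ≤ τ) (hl : ∀ θ ∈ l, θ ∈ Theta d)
    (h0 : ∀ θ ∈ l, ∀ x, 0 ≤ θ x) (γ : Tempered d) {s : ℝ} (hs : γ.Psi ≤ s) :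
    FHat 0 l γ * Real.exp (-τ * s) ≤ FHat τ l γ := by
  induction l generalizing γ with
  | nil =>
    have := mul_le_mul_of_nonneg_left hs hτ
    simp only [FHat, neg_zero, zero_mul, Real.exp_zero, one_mul, Real.exp_le_exp]
    linarith
  | cons θ l ih =>
    have hl' : ∀ θ' ∈ l, θ' ∈ Theta d := fun θ' h => hl θ' (by simp [h])
    have h0' : ∀ θ' ∈ l, ∀ x, 0 ≤ θ' x := fun θ' h => h0 θ' (by simp [h])
    simp only [FHat]
    rw [← Tempered.sum_mul_const]
    refine Tempered.sum_le_sum (summable_FHat hτ (hl θ (by simp)) hl' γ) (fun x hx => ?_)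
      fun x _ => mul_nonneg (h0 θ (by simp) x) (FHat_nonneg h0' _)
    rw [mul_assoc]
    exact mul_le_mul_of_nonneg_left (ih hl' h0' _ ((Tempered.Psi_erase_le hx).trans hs))
      (h0 θ (by simp) x)

/-- The new point either is used by none of the θ_i, and then contributes to the exponential only,
or is used by exactly one of them, which is then taken out of the list. -/
theorem FHat_insert (hτ : 0 ≤ τ) (hl : ∀ θ ∈ l, θ ∈ Theta d) (γ : Tempered d) (y : Space d) :
    FHat τ l (γ.insert y) = Real.exp (-τ * psi y) * FHat τ l γ +
      ((picks l).map fun p => p.1 y * FHat τ p.2 γ).sum := by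
  induction l generalizing γ with
  | nil =>
    simp only [FHat, picks, List.map_nil, List.sum_nil, add_zero, ← Real.exp_add,
      Tempered.Psi_insert]
    ring_nf
  | cons θ l ih =>
    have hθ := hl θ (by simp)
    have hl' : ∀ θ' ∈ l, θ' ∈ Theta d := fun θ' h => hl θ' (by simp [h])
    have h1 : ∀ x, γ.mult x ≠ 0 → θ x * FHat τ l ((γ.insert y).erase x)
        = θ x * FHat τ l (γ.erase x) * Real.exp (-τ * psi y) +
          ((picks l).map fun p => θ x * FHat τ p.2 (γ.erase x) * p.1 y).sum := by
      intro x hx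
      rw [Tempered.erase_insert_comm hx, ih hl', mul_add, ← List.sum_map_mul_left]
      congr 1
      · ring
      · refine congrArg List.sum (List.map_congr_left fun p _ => ?_)
        ring
    have h2 : Summable fun x => (γ.mult x : ℝ) *
        (θ x * FHat τ l (γ.erase x) * Real.exp (-τ * psi y)) := by
      simpa only [mul_assoc] using (summable_FHat hτ hθ hl' γ).mul_right (Real.exp (-τ * psi y))
    have h3 := γ.sum_list_sum (picks l) (fun p x => θ x * FHat τ p.2 (γ.erase x) * p.1 y)
      fun p hp => by
        simpa only [mul_assoc] using
          (summable_FHat hτ hθ (forall_of_mem_picks hl' hp).2 γ).mul_right (p.1 y)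
    have h4 : Summable fun x => (γ.mult x : ℝ) * (θ x * FHat τ l ((γ.insert y).erase x)) := by
      refine (h2.add h3.1).congr fun x => ?_
      by_cases hx : γ.mult x = 0
      · simp [hx]
      · rw [h1 x hx, mul_add]
    have h5 : FHat τ (θ :: l) (γ.insert y)
        = γ.sum (fun x => θ x * FHat τ l ((γ.insert y).erase x)) + θ y * FHat τ l γ := by
      simp only [FHat]
      rw [Tempered.sum_insert y h4, Tempered.erase_insert]
    rw [h5, Tempered.sum_congr h1, Tempered.sum_add h2 h3.1, h3.2]
    simp only [picks, List.map_cons, List.sum_cons, List.map_map, Function.comp_def,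
      Tempered.sum_mul_const, FHat]
    rw [List.map_congr_left (g := fun p : (Space d → ℝ) × List (Space d → ℝ) =>
      p.1 y * γ.sum fun x => θ x * FHat τ p.2 (γ.erase x)) fun p _ => mul_comm _ _]
    ring

/-- Apply `FHat_insert` to γ∖x with the point x and solve for `FHat τ l (γ.erase x)`. All lists on
the right are shorter than θ :: l, and the configurations with a point removed have been absorbed;
this yields continuity by strong induction on the length. -/
theorem FHat_cons_eq (hτ : 0 ≤ τ) {θ : Space d → ℝ} (hθ : θ ∈ Theta d)
    (hl : ∀ θ ∈ l, θ ∈ Theta d) (γ : Tempered d) :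
    FHat τ (θ :: l) γ = γ.sum (fun x => θ x * Real.exp (τ * psi x)) * FHat τ l γ -
      ((picks l).map fun p =>
        FHat τ ((fun x => θ x * Real.exp (τ * psi x) * p.1 x) :: p.2) γ).sum := by
  have hE : (fun x => θ x * Real.exp (τ * psi x)) ∈ Theta d := by
    refine bounded_mul_mem_theta (b := Real.exp τ) ?_ (fun x => ?_) hθ
    · have := continuous_psi (d := d); fun_prop
    · rw [abs_of_pos (Real.exp_pos _), Real.exp_le_exp]
      exact mul_le_of_le_one_right hτ (psi_le_one x)
  have h3 := γ.sum_list_sum (picks l)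
    (fun p x => θ x * Real.exp (τ * psi x) * p.1 x * FHat τ p.2 (γ.erase x)) fun p hp => by
      have h := forall_of_mem_picks hl hp
      exact summable_FHat hτ
        (bounded_mul_mem_theta h.1.1 (abs_le_of_mem_theta h.1) hE) h.2 γ
  rw [eq_sub_iff_add_eq, ← Tempered.sum_mul_const]
  simp only [FHat]
  rw [← h3.2, ← Tempered.sum_add (summable_FHat hτ hθ hl γ) h3.1]
  refine Tempered.sum_congr fun x hx => ?_
  have h := FHat_insert hτ hl (γ.erase x) x
  rw [Tempered.insert_erase hx] at h
  rw [h, mul_add, ← List.sum_map_mul_left]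
  congr 1
  · rw [neg_mul, Real.exp_neg]
    have := (Real.exp_pos (τ * psi x)).ne'
    field_simp
  · refine congrArg List.sum (List.map_congr_left fun p _ => ?_)
    ring

theorem continuous_FHat (hτ : 0 ≤ τ) (hl : ∀ θ ∈ l, θ ∈ Theta d) :
    Continuous (FHat (d := d) τ l) := by
  induction hn : l.length using Nat.strong_induction_on generalizing l with
  | _ n ih =>
  subst hn
  cases l with
  | nil =>
    have : Continuous fun γ : Tempered d => γ.Psi := Tempered.continuous_sum psi_mem_theta
    change Continuous fun γ : Tempered d => Real.exp (-τ * γ.Psi)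
    fun_prop
  | cons θ l =>
    have hθ := hl θ (by simp)
    have hl' : ∀ θ' ∈ l, θ' ∈ Theta d := fun θ' h => hl θ' (by simp [h])
    have hE : (fun x => θ x * Real.exp (τ * psi x)) ∈ Theta d := by
      refine bounded_mul_mem_theta (b := Real.exp τ) ?_ (fun x => ?_) hθ
      · have := continuous_psi (d := d); fun_prop
      · rw [abs_of_pos (Real.exp_pos _), Real.exp_le_exp]
        exact mul_le_of_le_one_right hτ (psi_le_one x)
    rw [show FHat τ (θ :: l) = _ from funext (FHat_cons_eq hτ hθ hl')]
    refine ((Tempered.continuous_sum hE).mul (ih _ (by simp) hl' rfl)).sub ?_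
    refine continuous_list_sum _ fun p hp => ?_
    have h := forall_of_mem_picks hl' hp
    refine ih _ ?_ (fun θ' h' => ?_) rfl
    · simp [length_of_mem_picks hp]
    · rcases List.mem_cons.1 h' with rfl | h'
      · exact bounded_mul_mem_theta h.1.1 (abs_le_of_mem_theta h.1) hE
      · exact h.2 _ h'

/-- One term of the exponential series gives s^m e^{-τ s} ≤ m! τ^{-m} with s = Ψ(γ). This is the
only a priori information on an arbitrary solution, and it degenerates as τ → 0. -/
theorem abs_FHat_le (hτ : 0 < τ) (hl : ∀ θ ∈ l, θ ∈ Theta d) (γ : Tempered d) :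
    |FHat τ l γ| ≤ (l.map psiNorm).prod * (l.length.factorial * (Real.exp τ / τ) ^ l.length) := by
  refine (abs_FHat_le_FHatBound hτ.le hl γ).trans ?_
  unfold FHatBound
  refine mul_le_mul_of_nonneg_left ?_ (prod_psiNorm_nonneg l)
  have h := Real.pow_div_factorial_le_exp (τ * γ.Psi) (mul_nonneg hτ.le γ.Psi_nonneg) l.length
  rw [div_le_iff₀ (by positivity), mul_pow] at h
  rw [neg_mul, Real.exp_neg, ← div_eq_mul_inv, div_le_iff₀ (Real.exp_pos _), mul_comm τ,
    Real.exp_nat_mul, div_pow]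
  have h1 : γ.Psi ^ l.length ≤ Real.exp (τ * γ.Psi) * l.length.factorial / τ ^ l.length := by
    rw [le_div_iff₀ (by positivity)]; linarith
  calc _ ≤ Real.exp τ ^ l.length * (Real.exp (τ * γ.Psi) * l.length.factorial / τ ^ l.length) := by
        gcongr
    _ = _ := by ring

end FHat

/-! ### The generator on the test functions -/

section Generator

variable {a φ : Space d → ℝ} {τ : ℝ} {l : List (Space d → ℝ)}

theorem expNeg_nonneg (s : ℝ≥0∞) : 0 ≤ expNeg s := by
  unfold expNeg; split_ifs <;> positivity

theorem expNeg_le_one (s : ℝ≥0∞) : expNeg s ≤ 1 := by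
  unfold expNeg
  split_ifs
  · exact zero_le_one
  · simp

theorem jumpRate_nonneg (h : ModelConditions a φ) (x y : Space d) (γ : Tempered d) :
    0 ≤ jumpRate a φ x y γ := mul_nonneg (h.nonneg_a _) (expNeg_nonneg _)

theorem jumpRate_le (h : ModelConditions a φ) (x y : Space d) (γ : Tempered d) :
    jumpRate a φ x y γ ≤ a (x - y) := mul_le_of_le_one_right (h.nonneg_a _) (expNeg_le_one _)

theorem integral_jump_list_sum (h : ModelConditions a φ) {ι : Type*} (L : List ι)
    (θ : ι → Space d → ℝ) (c : ι → ℝ) (hθ : ∀ i ∈ L, θ i ∈ Theta d) (x : Space d) :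
    (Integrable fun y => a (x - y) * (L.map fun i => θ i y * c i).sum) ∧
    ∫ y, a (x - y) * (L.map fun i => θ i y * c i).sum
      = (L.map fun i => jumpAverage a (θ i) x * c i).sum := by
  induction L with
  | nil => simp
  | cons i L ih =>
    obtain ⟨h1, h2⟩ := ih fun j hj => hθ j (by simp [hj])
    have h3 : Integrable fun y => a (x - y) * (θ i y * c i) := by
      simpa only [mul_assoc] using (integrable_jump_mul h (hθ i (by simp)) x).mul_const (c i)
    simp only [List.map_cons, List.sum_cons, mul_add]
    refine ⟨h3.add h1, ?_⟩
    rw [integral_add h3 h1, h2]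
    simp only [← mul_assoc]
    rw [integral_mul_const]
    rfl

/-- Both values are expanded around γ∖x by `FHat_insert`. The terms in which some θ_i uses x enter
with a minus sign and are dropped; the difference of the exponential factors is at most 1 -
e^{-τψ(x)} ≤ τψ(x). -/
theorem FHat_insert_sub_le (hτ : 0 ≤ τ) (hl : ∀ θ ∈ l, θ ∈ ThetaPlus d) {γ : Tempered d}
    {x : Space d} (hx : γ.mult x ≠ 0) (y : Space d) :
    FHat τ l ((γ.erase x).insert y) - FHat τ l γ ≤ τ * psi x * FHat τ l (γ.erase x) +
      ((picks l).map fun p => p.1 y * FHat τ p.2 (γ.erase x)).sum := by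
  have hl1 : ∀ θ ∈ l, θ ∈ Theta d := fun θ h => (mem_thetaPlus_iff.1 (hl θ h)).1
  have hl0 : ∀ θ ∈ l, ∀ x, 0 ≤ θ x := fun θ h x => ((mem_thetaPlus_iff.1 (hl θ h)).2 x).le
  have h1 := FHat_insert hτ hl1 (γ.erase x) x
  rw [Tempered.insert_erase hx] at h1
  rw [h1, FHat_insert hτ hl1]
  have h2 : 0 ≤ ((picks l).map fun p => p.1 x * FHat τ p.2 (γ.erase x)).sum := by
    refine List.sum_nonneg fun r hr => ?_
    obtain ⟨p, hp, rfl⟩ := List.mem_map.1 hr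
    have h := forall_of_mem_picks hl0 hp
    exact mul_nonneg (h.1 x) (FHat_nonneg h.2 _)
  have h3 := FHat_nonneg (τ := τ) hl0 (γ.erase x)
  have h4 : Real.exp (-τ * psi y) ≤ 1 := by
    rw [Real.exp_le_one_iff]
    have := mul_nonneg hτ (psi_pos y).le
    linarith
  have h5 : 1 - τ * psi x ≤ Real.exp (-τ * psi x) := by
    have := Real.add_one_le_exp (-τ * psi x)
    linarith
  nlinarith

/-- The bound on the increment is nonnegative, so the rate may be replaced by a(x - y). Integration
over y turns each θ_j into a∗θ_j, and the sum over x restores test functions. -/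
theorem generator_FHat_le (h : ModelConditions a φ) (hτ : 0 ≤ τ)
    (hl : ∀ θ ∈ l, θ ∈ ThetaPlus d) (γ : Tempered d) :
    generator a φ (FHat τ l) γ ≤ τ * FHat τ (psi :: l) γ +
      ((picks l).map fun p => FHat τ (jumpAverage a p.1 :: p.2) γ).sum := by
  have hl1 : ∀ θ ∈ l, θ ∈ Theta d := fun θ h => (mem_thetaPlus_iff.1 (hl θ h)).1
  have hl0 : ∀ θ ∈ l, ∀ x, 0 ≤ θ x := fun θ h x => ((mem_thetaPlus_iff.1 (hl θ h)).2 x).le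
  have hs1 := summable_FHat hτ psi_mem_theta hl1 γ
  have hs2 := γ.sum_list_sum (picks l)
    (fun p x => jumpAverage a p.1 x * FHat τ p.2 (γ.erase x)) fun p hp => by
      have h' := forall_of_mem_picks hl1 hp
      exact summable_FHat hτ (jumpAverage_mem_theta h h'.1) h'.2 γ
  have hs1' : Summable fun x => (γ.mult x : ℝ) * (psi x * FHat τ l (γ.erase x) * τ) := by
    simpa only [mul_assoc] using hs1.mul_right τ
  have hR : τ * FHat τ (psi :: l) γ +
      ((picks l).map fun p => FHat τ (jumpAverage a p.1 :: p.2) γ).sum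
      = γ.sum fun x => psi x * FHat τ l (γ.erase x) * τ +
        ((picks l).map fun p => jumpAverage a p.1 x * FHat τ p.2 (γ.erase x)).sum := by
    rw [Tempered.sum_add hs1' hs2.1, hs2.2, Tempered.sum_mul_const, mul_comm]
    rfl
  have hnn : ∀ x y, 0 ≤ τ * psi x * FHat τ l (γ.erase x) +
      ((picks l).map fun p => p.1 y * FHat τ p.2 (γ.erase x)).sum := by
    intro x y
    refine add_nonneg (mul_nonneg (mul_nonneg hτ (psi_pos x).le) (FHat_nonneg hl0 _))
      (List.sum_nonneg fun r hr => ?_)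
    obtain ⟨p, hp, rfl⟩ := List.mem_map.1 hr
    have h := forall_of_mem_picks hl0 hp
    exact mul_nonneg (h.1 y) (FHat_nonneg h.2 _)
  have hint : ∀ x, (Integrable fun y => a (x - y) * (τ * psi x * FHat τ l (γ.erase x) +
      ((picks l).map fun p => p.1 y * FHat τ p.2 (γ.erase x)).sum)) ∧
      ∫ y, a (x - y) * (τ * psi x * FHat τ l (γ.erase x) +
        ((picks l).map fun p => p.1 y * FHat τ p.2 (γ.erase x)).sum) =
      psi x * FHat τ l (γ.erase x) * τ +
        ((picks l).map fun p => jumpAverage a p.1 x * FHat τ p.2 (γ.erase x)).sum := by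
    intro x
    have h1 := integral_jump_list_sum h (picks l) (fun p => p.1) (fun p => FHat τ p.2 (γ.erase x))
      (fun p hp => (forall_of_mem_picks hl1 hp).1) x
    have h2 : Integrable fun y => a (x - y) * (τ * psi x * FHat τ l (γ.erase x)) :=
      (h.integrable_a.comp_sub_left x).mul_const _
    simp only [mul_add]
    refine ⟨h2.add h1.1, ?_⟩
    rw [integral_add h2 h1.1, h1.2, integral_mul_const, integral_jump h]
    ring
  rw [hR]
  refine Tempered.sum_le_sum ?_ (fun x hx => ?_) fun x _ => ?_
  · simpa only [mul_add] using hs1'.add hs2.1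
  · rw [← (hint x).2]
    -- If the integrand is not integrable, its integral is 0 by convention, which the nonnegative
    -- majorant still dominates.
    by_cases hi : Integrable fun y =>
        jumpRate a φ x y γ * (FHat τ l ((γ.erase x).insert y) - FHat τ l γ)
    · refine integral_mono hi (hint x).1 fun y => ?_
      exact (mul_le_mul_of_nonneg_left (FHat_insert_sub_le hτ hl hx y)
        (jumpRate_nonneg h x y γ)).trans
          (mul_le_mul_of_nonneg_right (jumpRate_le h x y γ) (hnn x y))
    · rw [integral_undef hi]
      exact integral_nonneg fun y => mul_nonneg (h.nonneg_a _) (hnn x y)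
  · rw [← (hint x).2]
    exact integral_nonneg fun y => mul_nonneg (h.nonneg_a _) (hnn x y)

end Generator

/-! ### Growth of product bounds along solutions -/

section Growth

variable {a φ : Space d → ℝ} {τ : ℝ} {l : List (Space d → ℝ)}

/-- `∏ ∫ θ` over the entries of a list. -/
def prodIntegral (l : List (Space d → ℝ)) : ℝ := (l.map fun θ => ∫ x, θ x).prod

theorem prodIntegral_nonneg (hl : ∀ θ ∈ l, θ ∈ ThetaPlus d) : 0 ≤ prodIntegral l :=
  List.prod_nonneg fun r hr => by
    obtain ⟨θ, hθ, rfl⟩ := List.mem_map.1 hr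
    exact integral_nonneg fun x => ((mem_thetaPlus_iff.1 (hl θ hθ)).2 x).le

/-- `μ(F) ≤ ϰ^m ∏ ∫ θ_i` for all the test functions `F` of order `m`. -/
def HasProductBound (μ : Measure (Tempered d)) (ϰ : ℝ) : Prop :=
  ∀ τ : ℝ, 0 < τ → ∀ l : List (Space d → ℝ), l ≠ [] → (∀ θ ∈ l, θ ∈ ThetaPlus d) →
    ∫ γ, FHat τ l γ ∂μ ≤ ϰ ^ l.length * prodIntegral l

theorem integrable_FHat (hτ : 0 < τ) (hl : ∀ θ ∈ l, θ ∈ Theta d) (μ : Measure (Tempered d))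
    [IsProbabilityMeasure μ] : Integrable (FHat τ l) μ :=
  Integrable.of_bound (continuous_FHat hτ.le hl).measurable.aestronglyMeasurable _
    (Filter.Eventually.of_forall fun γ => abs_FHat_le hτ hl γ)

theorem integral_FHat_le (hτ : 0 < τ) (hl : ∀ θ ∈ l, θ ∈ Theta d) (μ : Measure (Tempered d))
    [IsProbabilityMeasure μ] : ∫ γ, FHat τ l γ ∂μ ≤
      (l.map psiNorm).prod * (l.length.factorial * (Real.exp τ / τ) ^ l.length) := by
  have h := norm_integral_le_of_norm_le_const (μ := μ) (f := FHat τ l)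
    (Filter.Eventually.of_forall fun γ => abs_FHat_le hτ hl γ)
  simp only [probReal_univ, mul_one] at h
  exact (le_abs_self _).trans h

theorem integral_generator_FHat_le (h : ModelConditions a φ) (hτ : 0 < τ)
    (hl : ∀ θ ∈ l, θ ∈ ThetaPlus d) (μ : Measure (Tempered d)) [IsProbabilityMeasure μ] :
    ∫ γ, generator a φ (FHat τ l) γ ∂μ ≤ τ * ∫ γ, FHat τ (psi :: l) γ ∂μ +
      ((picks l).map fun p => ∫ γ, FHat τ (jumpAverage a p.1 :: p.2) γ ∂μ).sum := by
  have hl' : ∀ p ∈ picks l, ∀ θ ∈ jumpAverage a p.1 :: p.2, θ ∈ ThetaPlus d := by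
    intro p hp θ hθ
    have h' := forall_of_mem_picks hl hp
    rcases List.mem_cons.1 hθ with rfl | hθ
    · exact jumpAverage_mem_thetaPlus h h'.1
    · exact h'.2 θ hθ
  have hψ : ∀ θ ∈ psi :: l, θ ∈ ThetaPlus d := by
    intro θ hθ
    rcases List.mem_cons.1 hθ with rfl | hθ
    · exact psi_mem_thetaPlus
    · exact hl θ hθ
  have hsum : ∀ L : List ((Space d → ℝ) × List (Space d → ℝ)), (∀ p ∈ L, p ∈ picks l) →
      Integrable (fun γ => (L.map fun p => FHat τ (jumpAverage a p.1 :: p.2) γ).sum) μ ∧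
      ∫ γ, (L.map fun p => FHat τ (jumpAverage a p.1 :: p.2) γ).sum ∂μ
        = (L.map fun p => ∫ γ, FHat τ (jumpAverage a p.1 :: p.2) γ ∂μ).sum := by
    intro L hL
    induction L with
    | nil => simp
    | cons p L ih =>
      obtain ⟨h1, h2⟩ := ih fun q hq => hL q (by simp [hq])
      have h3 := integrable_FHat hτ
        (fun θ hθ => (mem_thetaPlus_iff.1 (hl' p (hL p (by simp)) θ hθ)).1) μ
      simp only [List.map_cons, List.sum_cons]
      exact ⟨h3.add h1, by rw [integral_add h3 h1, h2]⟩
  obtain ⟨h1, h2⟩ := hsum (picks l) fun _ h => h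
  have h3 : Integrable (fun γ => τ * FHat τ (psi :: l) γ) μ :=
    (integrable_FHat hτ (fun θ hθ => (mem_thetaPlus_iff.1 (hψ θ hθ)).1) μ).const_mul τ
  rw [← h2, ← integral_const_mul, ← integral_add h3 h1]
  -- Integrability of `generator a φ (FHat τ l)` is never established: otherwise its integral is 0,
  -- below the nonnegative right-hand side.
  by_cases hi : Integrable (generator a φ (FHat τ l)) μ
  · exact integral_mono hi (h3.add h1) fun γ => generator_FHat_le h hτ.le hl γ
  · rw [integral_undef hi]
    refine integral_nonneg fun γ => add_nonneg (mul_nonneg hτ.le (FHat_nonneg ?_ _))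
      (List.sum_nonneg fun r hr => ?_)
    · exact fun θ hθ x => ((mem_thetaPlus_iff.1 (hψ θ hθ)).2 x).le
    · obtain ⟨p, hp, rfl⟩ := List.mem_map.1 hr
      exact FHat_nonneg (fun θ hθ x => ((mem_thetaPlus_iff.1 (hl' p hp θ hθ)).2 x).le) _

/-- The integrand on the left need not be integrable: its integral then counts as `0`. -/
theorem intervalIntegral_le_sub_of_hasDerivAt {g A B : ℝ → ℝ} {s t : ℝ} (hst : s ≤ t)
    (hA : ∀ u, HasDerivAt A (B u) u) (hB : Continuous B) (hg : ∀ u ∈ Icc s t, g u ≤ B u)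
    (h0 : ∀ u ∈ Icc s t, 0 ≤ B u) : ∫ u in s..t, g u ≤ A t - A s := by
  rw [← intervalIntegral.integral_eq_sub_of_hasDerivAt (fun u _ => hA u) (hB.intervalIntegrable s t)]
  by_cases hi : IntervalIntegrable g volume s t
  · exact intervalIntegral.integral_mono_on hst hi (hB.intervalIntegrable s t) hg
  · rw [intervalIntegral.integral_undef hi]
    exact intervalIntegral.integral_nonneg hst h0

theorem prod_map_cons_picks (f : (Space d → ℝ) → ℝ) {p : (Space d → ℝ) × List (Space d → ℝ)}
    (hp : p ∈ picks l) : f p.1 * (p.2.map f).prod = (l.map f).prod := by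
  rw [← ((perm_of_mem_picks hp).map f).prod_eq, List.map_cons, List.prod_cons]

/-- One step of the iteration, in numbers. -/
theorem iteration_bound_le {C q w r e : ℝ} (hq : 0 ≤ q) (hw : 0 ≤ w) (hr : 0 ≤ r)
    (hC : 0 ≤ C) (he : 0 ≤ e) (m N : ℕ) :
    q * w * ((m + 1) * e) * (((C + e) * r) ^ N * ((m + 1 + N).choose N : ℕ)) +
      m * (C * q * w * (((C + e) * r) ^ N * ((m + N).choose N : ℕ))) ≤
    q * w * (((C + e) ^ (N + 1) * ((N + 1 : ℕ) * r ^ N)) * ((m + (N + 1)).choose (N + 1) : ℕ)) := by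
  have h1 : ((m + (N + 1)).choose (N + 1) : ℝ) * (N + 1) = (m + N + 1) * (m + N).choose N := by
    have := Nat.add_one_mul_choose_eq (m + N) N
    exact_mod_cast this.symm
  have h2 : ((m + 1 + N).choose N : ℝ) * (m + 1) = (m + N + 1) * (m + N).choose N := by
    have := Nat.choose_mul_succ_eq (m + N) N
    rw [show m + N + 1 - N = m + 1 by omega, show m + N + 1 = m + 1 + N by omega] at this
    have h' : ((m + N).choose N : ℝ) * (m + 1 + N) = (m + 1 + N).choose N * (m + 1) := by
      exact_mod_cast this
    linarith
  have h3 : (m : ℝ) * (m + N).choose N ≤ (m + N + 1) * (m + N).choose N := by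
    gcongr
    have : (0 : ℝ) ≤ N := Nat.cast_nonneg N
    linarith
  have h4 : 0 ≤ q * w * ((C + e) ^ N * r ^ N) := by positivity
  calc _ = q * w * ((C + e) ^ N * r ^ N) *
        (e * (((m + 1 + N).choose N : ℝ) * (m + 1)) + C * (m * (m + N).choose N)) := by
        rw [mul_pow]; ring
    _ ≤ q * w * ((C + e) ^ N * r ^ N) *
        (e * ((m + N + 1) * (m + N).choose N) + C * ((m + N + 1) * (m + N).choose N)) := by
        rw [h2]; gcongr
    _ = q * w * ((C + e) ^ N * r ^ N) * ((C + e) * ((m + N + 1) * (m + N).choose N)) := by ring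
    _ = _ := by rw [← h1]; push_cast; ring

/-- N-fold iteration of the hierarchy, by induction on N with the list and the time free. For N = 0
the remainder alone, which is then the a priori bound, suffices. The induction step inserts the
estimate for N into the integrated equation. -/
theorem integral_FHat_le_iterated (h : ModelConditions a φ) {μ : ℝ → Measure (Tempered d)}
    (hμ : SolvesFokkerPlanck a φ (Submodule.span ℝ (FHatSet d) : Set (Tempered d → ℝ)) μ)
    {s ϰ : ℝ} (hs : 0 ≤ s) (hϰ : 0 ≤ ϰ) (hb : HasProductBound (μ s) ϰ) (hτ : 0 < τ) (N : ℕ)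
    (l : List (Space d → ℝ)) (hne : l ≠ []) (hl : ∀ θ ∈ l, θ ∈ ThetaPlus d)
    {t : ℝ} (ht : s ≤ t) :
    ∫ γ, FHat τ l γ ∂(μ t) ≤
      ϰ ^ l.length * prodIntegral l * Real.exp (l.length * (t - s) +
        τ * ϰ * (∫ x : Space d, psi x) * (Real.exp (t - s) - 1)) +
      (l.map psiNorm).prod * (l.length.factorial * (Real.exp τ / τ) ^ l.length) *
        (((jumpConst a + Real.exp τ) * (t - s)) ^ N * ((l.length + N).choose N : ℕ)) := by
  set β := τ * ϰ * (∫ x : Space d, psi x) with hβ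
  have hψ0 : 0 ≤ ∫ x : Space d, psi x := integral_nonneg fun x => (psi_pos x).le
  have hβ0 : 0 ≤ β := by positivity
  have hC := jumpConst_nonneg h
  have hE := (Real.exp_pos τ).le
  induction N generalizing l t with
  | zero =>
    have := hμ.isProbabilityMeasure t (hs.trans ht)
    have h1 := integral_FHat_le hτ (fun θ hθ => (mem_thetaPlus_iff.1 (hl θ hθ)).1) (μ t)
    have h2 := prodIntegral_nonneg hl
    simp only [pow_zero, Nat.choose_zero_right, Nat.cast_one, mul_one]
    exact h1.trans (le_add_of_nonneg_left (by positivity))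
  | succ N ih =>
    have hp := prodIntegral_nonneg hl
    have hq := prod_psiNorm_nonneg l
    set m := l.length with hm
    set w := (m.factorial : ℝ) * (Real.exp τ / τ) ^ m with hw
    have hw0 : 0 ≤ w := by positivity
    set p := prodIntegral l with hpdef
    set q := (l.map psiNorm).prod with hqdef
    set c : ℝ := (((m + (N + 1)).choose (N + 1) : ℕ) : ℝ) with hc
    have hc0 : 0 ≤ c := Nat.cast_nonneg _
    set K := jumpConst a + Real.exp τ with hK
    have hK0 : 0 ≤ K := add_nonneg hC hE
    -- `A` is the claimed bound at time u and `B` its derivative, so it suffices to bound the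
    -- generator term by `B`. The main term of `B` is exactly what the main terms of orders m and m
    -- + 1 add up to.
    let A : ℝ → ℝ := fun u => ϰ ^ m * p * Real.exp (m * (u - s) + β * (Real.exp (u - s) - 1)) +
      q * w * ((K * (u - s)) ^ (N + 1) * c)
    let B : ℝ → ℝ := fun u => ϰ ^ m * p * (Real.exp (m * (u - s) + β * (Real.exp (u - s) - 1)) *
      (m + β * Real.exp (u - s))) + q * w * ((K ^ (N + 1) * ((N + 1 : ℕ) * (u - s) ^ N)) * c)
    have hA : ∀ u, HasDerivAt A (B u) u := by
      intro u
      have h1 : HasDerivAt (fun u => u - s) 1 u := (hasDerivAt_id u).sub_const s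
      have h2 : HasDerivAt (fun u => Real.exp (m * (u - s) + β * (Real.exp (u - s) - 1)))
          (Real.exp (m * (u - s) + β * (Real.exp (u - s) - 1)) *
            (m + β * Real.exp (u - s))) u := by
        have := ((h1.const_mul (m : ℝ)).add ((h1.exp.sub_const 1).const_mul β)).exp
        simpa using this
      have h3 : HasDerivAt (fun u => (K * (u - s)) ^ (N + 1) * c)
          ((K ^ (N + 1) * ((N + 1 : ℕ) * (u - s) ^ N)) * c) u := by
        have := ((h1.pow (N + 1)).const_mul (K ^ (N + 1))).mul_const c
        simpa [mul_pow] using this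
      exact (h2.const_mul _).add (h3.const_mul _)
    have hB : Continuous B := by fun_prop
    have hB0 : ∀ u ∈ Icc s t, 0 ≤ B u := by
      intro u hu
      have : 0 ≤ u - s := sub_nonneg.2 hu.1
      positivity
    have hAs : A s = ϰ ^ m * p := by simp [A]
    -- The equation is available only for distinct times; at u = s the remainder vanishes because
    -- its exponent is N + 1.
    rcases ht.eq_or_lt with rfl | hlt
    · have : A s = _ := hAs
      change _ ≤ A s
      rw [hAs]
      exact hb τ hτ l hne hl
    have hgen : ∀ u ∈ Icc s t, ∫ γ, generator a φ (FHat τ l) γ ∂(μ u) ≤ B u := by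
      intro u hu
      have := hμ.isProbabilityMeasure u (hs.trans hu.1)
      have hr : 0 ≤ u - s := sub_nonneg.2 hu.1
      refine (integral_generator_FHat_le h hτ hl (μ u)).trans ?_
      set S := Real.exp (m * (u - s) + β * (Real.exp (u - s) - 1)) with hS
      have h1 : ∫ γ, FHat τ (psi :: l) γ ∂(μ u) ≤
          ϰ ^ (m + 1) * ((∫ x : Space d, psi x) * p) * (S * Real.exp (u - s)) +
          q * ((m + 1) * (m.factorial : ℝ) * (Real.exp τ / τ) ^ (m + 1)) *
            ((K * (u - s)) ^ N * ((m + 1 + N).choose N : ℕ)) := by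
        refine (ih (psi :: l) (by simp) ?_ hu.1).trans ?_
        · intro θ hθ
          rcases List.mem_cons.1 hθ with rfl | hθ
          · exact psi_mem_thetaPlus
          · exact hl θ hθ
        · have e1 : prodIntegral (psi :: l) = (∫ x : Space d, psi x) * p := by
            simp [prodIntegral, hpdef]
          have e2 : ((psi :: l).map psiNorm).prod ≤ q := by
            simp only [List.map_cons, List.prod_cons]
            exact mul_le_of_le_one_left hq psiNorm_psi_le
          have e3 : Real.exp (((m + 1 : ℕ) : ℝ) * (u - s) + β * (Real.exp (u - s) - 1))
              = S * Real.exp (u - s) := by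
            rw [hS, ← Real.exp_add]; push_cast; ring_nf
          simp only [List.length_cons, ← hm]
          rw [e1, e3, Nat.factorial_succ]
          push_cast
          gcongr
      have h2 : ∀ r ∈ (picks l).map (fun p => ∫ γ, FHat τ (jumpAverage a p.1 :: p.2) γ ∂(μ u)),
          r ≤ ϰ ^ m * p * S + jumpConst a * q * w * ((K * (u - s)) ^ N * ((m + N).choose N : ℕ)) := by
        intro r hr'
        obtain ⟨π, hπ, rfl⟩ := List.mem_map.1 hr'
        have h' := forall_of_mem_picks hl hπ
        have hθ1 := (mem_thetaPlus_iff.1 h'.1).1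
        refine (ih (jumpAverage a π.1 :: π.2) (by simp) ?_ hu.1).trans ?_
        · intro θ hθ
          rcases List.mem_cons.1 hθ with rfl | hθ
          · exact jumpAverage_mem_thetaPlus h h'.1
          · exact h'.2 θ hθ
        · have e1 : prodIntegral (jumpAverage a π.1 :: π.2) = p := by
            rw [hpdef, prodIntegral, prodIntegral, ← prod_map_cons_picks _ hπ, List.map_cons,
              List.prod_cons, integral_jumpAverage h hθ1]
          have e2 : ((jumpAverage a π.1 :: π.2).map psiNorm).prod ≤ jumpConst a * q := by
            rw [hqdef, ← prod_map_cons_picks _ hπ, List.map_cons, List.prod_cons, ← mul_assoc]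
            exact mul_le_mul_of_nonneg_right (psiNorm_jumpAverage_le h hθ1)
              (prod_psiNorm_nonneg _)
          have e3 : (jumpAverage a π.1 :: π.2).length = m := length_of_mem_picks hπ
          rw [e1, e3]
          gcongr
      have h3 := List.sum_le_card_nsmul _ _ h2
      rw [List.length_map, length_picks, ← hm, nsmul_eq_mul] at h3
      have h4 := mul_le_mul_of_nonneg_left h1 hτ.le
      have h5 := iteration_bound_le hq hw0 hr hC hE m N
      rw [← hK, ← hc] at h5
      -- The additional factor ψ costs (m + 1) e^τ/τ in the a priori bound, and the τ in front of
      -- this term cancels the 1/τ.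
      have h6 : τ * (q * ((m + 1) * (m.factorial : ℝ) * (Real.exp τ / τ) ^ (m + 1)) *
            ((K * (u - s)) ^ N * ((m + 1 + N).choose N : ℕ))) =
          q * w * ((m + 1) * Real.exp τ) * ((K * (u - s)) ^ N * ((m + 1 + N).choose N : ℕ)) := by
        rw [hw, pow_succ]
        field_simp
      have h7 : τ * (ϰ ^ (m + 1) * ((∫ x : Space d, psi x) * p) * (S * Real.exp (u - s)))
          = ϰ ^ m * p * (S * (β * Real.exp (u - s))) := by
        rw [hβ]; ring
      change _ ≤ ϰ ^ m * p * (S * (m + β * Real.exp (u - s))) +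
        q * w * ((K ^ (N + 1) * ((N + 1 : ℕ) * (u - s) ^ N)) * c)
      rw [mul_add, h6, h7] at h4
      linarith
    have hmem : FHat τ l ∈ (Submodule.span ℝ (FHatSet d) : Set (Tempered d → ℝ)) :=
      Submodule.subset_span ⟨τ, l, hτ, hne, hl, rfl⟩
    have h1 := intervalIntegral_le_sub_of_hasDerivAt hlt.le hA hB hgen hB0
    have h2 := hb τ hτ l hne hl
    rw [hμ.equation _ hmem s t hs hlt]
    change _ ≤ A t
    rw [hAs] at h1
    linarith

end Growth

/-! ### Short time steps and their concatenation -/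

section Growth

variable {a φ : Space d → ℝ}

theorem HasProductBound.of_short_time (h : ModelConditions a φ) {μ : ℝ → Measure (Tempered d)}
    (hμ : SolvesFokkerPlanck a φ (Submodule.span ℝ (FHatSet d) : Set (Tempered d → ℝ)) μ)
    {s t ϰ : ℝ} (hs : 0 ≤ s) (hϰ : 0 ≤ ϰ) (hb : HasProductBound (μ s) ϰ) (hst : s ≤ t)
    (ht : (jumpConst a + Real.exp 1) * (t - s) ≤ 1 / 4) :
    HasProductBound (μ t) (ϰ * Real.exp (t - s)) := by
  intro τ hτ l hne hl
  have hl1 : ∀ θ ∈ l, θ ∈ Theta d := fun θ h => (mem_thetaPlus_iff.1 (hl θ h)).1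
  have hl0 : ∀ θ ∈ l, ∀ x, 0 ≤ θ x := fun θ h x => ((mem_thetaPlus_iff.1 (hl θ h)).2 x).le
  have := hμ.isProbabilityMeasure t (hs.trans hst)
  have hr : 0 ≤ t - s := sub_nonneg.2 hst
  have hC := jumpConst_nonneg h
  -- With σ ≤ 1 one has e^σ ≤ e, so the base of the remainder is at most 1/4. As the binomial
  -- coefficient is at most 2^(m+N), the remainder is of order 2^(-N) and vanishes as N → ∞.
  have key : ∀ σ : ℝ, 0 < σ → σ ≤ 1 → ∫ γ, FHat σ l γ ∂(μ t) ≤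
      ϰ ^ l.length * prodIntegral l * Real.exp (l.length * (t - s) +
        σ * ϰ * (∫ x : Space d, psi x) * (Real.exp (t - s) - 1)) := by
    intro σ hσ hσ1
    set b := ϰ ^ l.length * prodIntegral l * Real.exp (l.length * (t - s) +
        σ * ϰ * (∫ x : Space d, psi x) * (Real.exp (t - s) - 1))
    set v := (l.map psiNorm).prod * (l.length.factorial * (Real.exp σ / σ) ^ l.length)
    have hv : 0 ≤ v := mul_nonneg (prod_psiNorm_nonneg l) (by positivity)
    have h1 : ∀ N : ℕ, ∫ γ, FHat σ l γ ∂(μ t) ≤ b + v * (2 ^ l.length * (1 / 2 : ℝ) ^ N) := by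
      intro N
      refine (integral_FHat_le_iterated h hμ hs hϰ hb hσ N l hne hl hst).trans ?_
      have h2 : (jumpConst a + Real.exp σ) * (t - s) ≤ 1 / 4 := by
        refine le_trans ?_ ht
        gcongr
      have h3 : ((l.length + N).choose N : ℝ) ≤ 2 ^ (l.length + N) := by
        exact_mod_cast Nat.choose_le_two_pow (l.length + N) N
      have h0 : 0 ≤ (jumpConst a + Real.exp σ) * (t - s) := by positivity
      have h4 : ((jumpConst a + Real.exp σ) * (t - s)) ^ N * ((l.length + N).choose N : ℝ)
          ≤ (1 / 4) ^ N * 2 ^ (l.length + N) := by gcongr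
      have h5 : (1 / 4 : ℝ) ^ N * 2 ^ (l.length + N) = 2 ^ l.length * (1 / 2) ^ N := by
        rw [pow_add, mul_left_comm, ← mul_pow]; norm_num
      rw [h5] at h4
      gcongr
    refine ge_of_tendsto' (f := fun N : ℕ => b + v * (2 ^ l.length * (1 / 2 : ℝ) ^ N))
      (x := Filter.atTop) ?_ h1
    have h6 := tendsto_pow_atTop_nhds_zero_of_lt_one (r := (1 / 2 : ℝ)) (by norm_num) (by norm_num)
    simpa using ((h6.const_mul (2 ^ l.length)).const_mul v).const_add b
  have hlim : Filter.Tendsto (fun σ : ℝ => ϰ ^ l.length * prodIntegral l *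
      Real.exp (l.length * (t - s) + σ * ϰ * (∫ x : Space d, psi x) * (Real.exp (t - s) - 1)))
      (nhdsWithin 0 (Ioi 0)) (nhds ((ϰ * Real.exp (t - s)) ^ l.length * prodIntegral l)) := by
    have hc : Continuous fun σ : ℝ => ϰ ^ l.length * prodIntegral l *
      Real.exp (l.length * (t - s) + σ * ϰ * (∫ x : Space d, psi x) * (Real.exp (t - s) - 1)) := by
      fun_prop
    convert (hc.tendsto 0).mono_left nhdsWithin_le_nhds using 2
    rw [mul_pow, ← Real.exp_nat_mul]
    ring_nf
  -- `FHat` decreases in its parameter, so the value at τ is bounded by that at any smaller σ, and σ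
  -- → 0 removes the coupling term from the exponent.
  refine ge_of_tendsto hlim ?_
  filter_upwards [Ioc_mem_nhdsGT (lt_min hτ one_pos)] with σ hσ
  have hστ := hσ.2.trans (min_le_left _ _)
  exact (integral_mono (integrable_FHat hτ hl1 _) (integrable_FHat hσ.1 hl1 _)
    fun γ => FHat_antitone hσ.1.le hστ hl1 hl0 γ).trans
      (key σ hσ.1 (hσ.2.trans (min_le_right _ _)))

/-- The step length δ = 1/(4K) depends neither on ϰ nor on the starting time, so finitely many short
steps reach any t, and their factors multiply to e^t. -/
theorem HasProductBound.of_solves (h : ModelConditions a φ) {μ : ℝ → Measure (Tempered d)}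
    (hμ : SolvesFokkerPlanck a φ (Submodule.span ℝ (FHatSet d) : Set (Tempered d → ℝ)) μ)
    {ϰ : ℝ} (hϰ : 0 ≤ ϰ) (hb : HasProductBound (μ 0) ϰ) {t : ℝ} (ht : 0 ≤ t) :
    HasProductBound (μ t) (ϰ * Real.exp t) := by
  set K := jumpConst a + Real.exp 1
  have hK : 0 < K := add_pos_of_nonneg_of_pos (jumpConst_nonneg h) (Real.exp_pos 1)
  set δ := 1 / (4 * K) with hδ
  have hδ0 : 0 < δ := by positivity
  have key : ∀ n : ℕ, ∀ t, 0 ≤ t → t ≤ n * δ → HasProductBound (μ t) (ϰ * Real.exp t) := by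
    intro n
    induction n with
    | zero =>
      intro t h0 h1
      have : t = 0 := le_antisymm (by simpa using h1) h0
      subst this
      simpa using hb
    | succ n ih =>
      intro t h0 h1
      by_cases h2 : t ≤ n * δ
      · exact ih t h0 h2
      · have h3 : (0 : ℝ) ≤ n * δ := by positivity
        have h4 := HasProductBound.of_short_time h hμ h3 (by positivity) (ih (n * δ) h3 le_rfl)
          (not_le.1 h2).le (by
            push_cast at h1
            calc K * (t - n * δ) ≤ K * δ := by gcongr; linarith
              _ = 1 / 4 := by rw [hδ]; field_simp)
        rwa [mul_assoc, ← Real.exp_add, add_sub_cancel] at h4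
  obtain ⟨n, hn⟩ := exists_nat_ge (t / δ)
  exact key n t ht ((div_le_iff₀ hδ0).1 hn)

end Growth

/-! ### Factorial measures -/

theorem measurable_fin_cons {n : ℕ} (x : Space d) :
    Measurable fun v : Fin n → Space d => (Fin.cons x v : Fin (n + 1) → Space d) := by
  refine measurable_pi_iff.2 fun i => ?_
  refine Fin.cases ?_ (fun j => ?_) i
  · simp
  · simpa using measurable_pi_apply j

theorem lintegral_factorialMeasure_succ {n : ℕ} (γ : Tempered d)
    {f : (Fin (n + 1) → Space d) → ℝ≥0∞} (hf : Measurable f) :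
    ∫⁻ v, f v ∂(factorialMeasure (n + 1) γ) =
      ∑' x, (γ.mult x : ℝ≥0∞) * ∫⁻ v, f (Fin.cons x v) ∂(factorialMeasure n (γ.erase x)) := by
  rw [factorialMeasure, lintegral_sum_measure]
  refine tsum_congr fun x => ?_
  rw [lintegral_smul_measure, lintegral_map hf (measurable_fin_cons x), smul_eq_mul]

theorem lintegral_prod_factorialMeasure {n : ℕ} (θ : Fin n → Space d → ℝ)
    (hθ : ∀ i, θ i ∈ Theta d) (h0 : ∀ i x, 0 ≤ θ i x) (γ : Tempered d) :
    ∫⁻ v, ∏ i, ENNReal.ofReal (θ i (v i)) ∂(factorialMeasure n γ)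
      = ENNReal.ofReal (FHat 0 (List.ofFn θ) γ) := by
  induction n generalizing γ with
  | zero => simp [factorialMeasure, FHat]
  | succ n ih =>
    have hm : ∀ i, Measurable (θ i) := fun i => (hθ i).1.measurable
    rw [lintegral_factorialMeasure_succ γ (by fun_prop), List.ofFn_succ]
    have hl : ∀ θ' ∈ List.ofFn (fun i : Fin n => θ i.succ), θ' ∈ Theta d := by
      intro θ' h; obtain ⟨i, rfl⟩ := List.mem_ofFn.1 h; exact hθ _
    have hl0 : ∀ θ' ∈ List.ofFn (fun i : Fin n => θ i.succ), ∀ x, 0 ≤ θ' x := by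
      intro θ' h; obtain ⟨i, rfl⟩ := List.mem_ofFn.1 h; exact h0 _
    have hs := summable_FHat (τ := 0) le_rfl (hθ 0) hl γ
    simp only [FHat, Tempered.sum]
    rw [ENNReal.ofReal_tsum_of_nonneg (fun x => mul_nonneg (Nat.cast_nonneg _)
      (mul_nonneg (h0 0 x) (FHat_nonneg hl0 _))) hs]
    refine tsum_congr fun x => ?_
    simp only [Fin.prod_univ_succ, Fin.cons_zero, Fin.cons_succ]
    rw [lintegral_const_mul _ (by fun_prop), ih _ (fun i => hθ i.succ) (fun i => h0 i.succ),
      ENNReal.ofReal_mul (Nat.cast_nonneg _), ENNReal.ofReal_mul (h0 0 x), ENNReal.ofReal_natCast]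

/-- Continuous functions with values in `[0, 1]` that converge to the indicator of an open set. -/
def openApprox {U : Set (Space d)} (hU : IsOpen U) (k : ℕ) (x : Space d) : ℝ :=
  1 - (hU.isClosed_compl.apprSeq k x : ℝ)

section OpenApprox

variable {U : Set (Space d)} (hU : IsOpen U)

theorem continuous_openApprox (k : ℕ) : Continuous (openApprox hU k) :=
  continuous_const.sub (NNReal.continuous_coe.comp (hU.isClosed_compl.apprSeq k).continuous)

theorem openApprox_nonneg (k : ℕ) (x : Space d) : 0 ≤ openApprox hU k x :=
  sub_nonneg.2 (NNReal.coe_le_one.2 (HasOuterApproxClosed.apprSeq_apply_le_one _ k x))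

theorem openApprox_le_one (k : ℕ) (x : Space d) : openApprox hU k x ≤ 1 :=
  sub_le_self _ (NNReal.coe_nonneg _)

theorem openApprox_eq_zero (k : ℕ) {x : Space d} (hx : x ∉ U) : openApprox hU k x = 0 := by
  rw [openApprox, HasOuterApproxClosed.apprSeq_apply_eq_one _ k (show x ∈ Uᶜ from hx)]
  simp

theorem tendsto_openApprox (x : Space d) :
    Filter.Tendsto (fun k => openApprox hU k x) Filter.atTop (nhds (U.indicator 1 x)) := by
  have h := (tendsto_pi_nhds.1 (HasOuterApproxClosed.tendsto_apprSeq hU.isClosed_compl) x)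
  have h1 := (NNReal.continuous_coe.tendsto _).comp h
  have h2 := h1.const_sub 1
  refine h2.congr' (Filter.Eventually.of_forall fun k => rfl) |>.trans (le_of_eq ?_)
  by_cases hx : x ∈ U <;> simp [hx]

end OpenApprox

theorem tendsto_prod_openApprox {n : ℕ} {U : Fin n → Set (Space d)} (hU : ∀ i, IsOpen (U i))
    (v : Fin n → Space d) :
    Filter.Tendsto (fun k => ∏ i, ENNReal.ofReal (openApprox (hU i) k (v i))) Filter.atTop
      (nhds ((univ.pi U).indicator 1 v)) := by
  have h : (univ.pi U).indicator (1 : (Fin n → Space d) → ℝ≥0∞) v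
      = ENNReal.ofReal (∏ i, (U i).indicator 1 (v i)) := by
    by_cases hv : v ∈ univ.pi U
    · have : ∀ i, v i ∈ U i := fun i => hv i (mem_univ i)
      simp [hv, this]
    · obtain ⟨i, hi⟩ : ∃ i, v i ∉ U i := by simpa [mem_pi] using hv
      rw [indicator_of_notMem hv, Finset.prod_eq_zero (Finset.mem_univ i)
        (indicator_of_notMem hi _), ENNReal.ofReal_zero]
  rw [h]
  simp_rw [← ENNReal.ofReal_prod_of_nonneg fun i (_ : i ∈ Finset.univ) =>
    openApprox_nonneg (hU i) _ (v i)]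
  exact (ENNReal.continuous_ofReal.tendsto _).comp
    (tendsto_finsetProd _ fun i _ => tendsto_openApprox (hU i) (v i))

/-! ### Measurability of the factorial measures -/

/-- The factorial measure with the finite weight `ψ ⊗ ⋯ ⊗ ψ`. -/
def weightedFactorialMeasure (n : ℕ) (γ : Tempered d) : Measure (Fin n → Space d) :=
  (factorialMeasure n γ).withDensity fun v => ∏ i, ENNReal.ofReal (psi (v i))

theorem measurable_prod_psi (n : ℕ) :
    Measurable fun v : Fin n → Space d => ∏ i, ENNReal.ofReal (psi (v i)) := by
  have := (continuous_psi (d := d)).measurable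
  fun_prop

theorem lintegral_prod_weightedFactorialMeasure {n : ℕ} {g : Fin n → Space d → ℝ}
    (hg : ∀ i, Continuous (g i)) (h0 : ∀ i x, 0 ≤ g i x) (h1 : ∀ i x, g i x ≤ 1)
    (γ : Tempered d) : ∫⁻ v, ∏ i, ENNReal.ofReal (g i (v i)) ∂(weightedFactorialMeasure n γ)
      = ENNReal.ofReal (FHat 0 (List.ofFn fun i x => psi x * g i x) γ) := by
  have hm : ∀ i, Measurable (g i) := fun i => (hg i).measurable
  rw [weightedFactorialMeasure, lintegral_withDensity_eq_lintegral_mul _ (measurable_prod_psi n)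
    (by fun_prop), ← lintegral_prod_factorialMeasure]
  · refine lintegral_congr fun v => ?_
    simp only [Pi.mul_apply, ← Finset.prod_mul_distrib]
    exact Finset.prod_congr rfl fun i _ => (ENNReal.ofReal_mul (psi_pos _).le).symm
  · exact fun i => bounded_mul_mem_theta (hg i)
      (fun x => (abs_of_nonneg (h0 i x)).trans_le (h1 i x)) psi_mem_theta
  · exact fun i x => mul_nonneg (psi_pos x).le (h0 i x)

instance (n : ℕ) (γ : Tempered d) : IsFiniteMeasure (weightedFactorialMeasure n γ) := by
  refine ⟨?_⟩
  have h := lintegral_prod_weightedFactorialMeasure (n := n) (g := fun _ _ => 1)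
    (fun _ => continuous_const) (fun _ _ => zero_le_one) (fun _ _ => le_rfl) γ
  simp only [ENNReal.ofReal_one, Finset.prod_const_one, lintegral_one] at h
  rw [h]
  exact ENNReal.ofReal_lt_top

theorem measurable_FHat_ofFn {n : ℕ} {g : Fin n → Space d → ℝ}
    (hg : ∀ i, Continuous (g i)) (h0 : ∀ i x, 0 ≤ g i x) (h1 : ∀ i x, g i x ≤ 1) :
    Measurable fun γ : Tempered d =>
      ENNReal.ofReal (FHat 0 (List.ofFn fun i x => psi x * g i x) γ) := by
  refine (continuous_FHat le_rfl fun θ hθ => ?_).measurable.ennreal_ofReal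
  obtain ⟨i, rfl⟩ := List.mem_ofFn.1 hθ
  exact bounded_mul_mem_theta (hg i)
    (fun x => (abs_of_nonneg (h0 i x)).trans_le (h1 i x)) psi_mem_theta

/-- The indicator of an open box is a limit of products of continuous functions, whose integrals are
continuous functions `FHat 0` of γ. Dominated convergence applies because the weighted measure is
finite. -/
theorem measurable_weightedFactorialMeasure_openBox {n : ℕ} {U : Fin n → Set (Space d)}
    (hU : ∀ i, IsOpen (U i)) :
    Measurable fun γ : Tempered d => weightedFactorialMeasure n γ (univ.pi U) := by
  have h : ∀ γ : Tempered d, Filter.Tendsto (fun k => ENNReal.ofReal (FHat 0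
      (List.ofFn fun i x => psi x * openApprox (hU i) k x) γ)) Filter.atTop
      (nhds (weightedFactorialMeasure n γ (univ.pi U))) := by
    intro γ
    have h1 := tendsto_lintegral_of_dominated_convergence (μ := weightedFactorialMeasure n γ)
      (F := fun k v => ∏ i, ENNReal.ofReal (openApprox (hU i) k (v i))) (fun _ => 1)
      (fun k => by
        have : ∀ i, Measurable (openApprox (hU i) k) :=
          fun i => (continuous_openApprox (hU i) k).measurable
        fun_prop)
      (fun k => Filter.Eventually.of_forall fun v => Finset.prod_le_one' fun i _ =>
        ENNReal.ofReal_le_one.2 (openApprox_le_one (hU i) k _))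
      (by simp) (Filter.Eventually.of_forall fun v => tendsto_prod_openApprox hU v)
    rw [lintegral_indicator_one (MeasurableSet.univ_pi fun i => (hU i).measurableSet)] at h1
    refine h1.congr fun k => ?_
    exact lintegral_prod_weightedFactorialMeasure (fun i => continuous_openApprox (hU i) k)
      (fun i => openApprox_nonneg (hU i) k) (fun i => openApprox_le_one (hU i) k) γ
  exact measurable_of_tendsto_metrizable (fun k => measurable_FHat_ofFn
    (fun i => continuous_openApprox (hU i) k) (fun i => openApprox_nonneg (hU i) k)
    (fun i => openApprox_le_one (hU i) k)) (tendsto_pi_nhds.2 h)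

theorem pi_eq_generateFrom_openBox (n : ℕ) :
    (MeasurableSpace.pi : MeasurableSpace (Fin n → Space d)) = MeasurableSpace.generateFrom
      (univ.pi '' univ.pi fun _ : Fin n => {U : Set (Space d) | IsOpen U}) := by
  rw [← generateFrom_pi_eq (C := fun _ : Fin n => {U : Set (Space d) | IsOpen U}) fun _ => ⟨fun _ => univ, by simp, iUnion_const _⟩]
  congr 1
  funext _
  exact BorelSpace.measurable_eq

theorem measurable_weightedFactorialMeasure (n : ℕ) :
    Measurable (weightedFactorialMeasure (d := d) n) := by
  refine Measurable.measure_of_isPiSystem (pi_eq_generateFrom_openBox n)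
    (IsPiSystem.pi fun _ => isPiSystem_isOpen) ?_ ?_
  · rintro _ ⟨U, hU, rfl⟩
    exact measurable_weightedFactorialMeasure_openBox fun i => hU i (mem_univ i)
  · have h := measurable_weightedFactorialMeasure_openBox (d := d) (n := n)
      (U := fun _ => univ) fun _ => isOpen_univ
    rwa [pi_univ] at h

/-- Needed to compute integrals against the `bind` that defines `correlationMeasure`. A π-system
argument works for the finite weighted measures, and the weight, being positive and finite, is
undone by its reciprocal. -/
theorem measurable_factorialMeasure (n : ℕ) : Measurable (factorialMeasure (d := d) n) := by
  have hpos : ∀ v : Fin n → Space d, ∏ i, ENNReal.ofReal (psi (v i)) ≠ 0 := fun v =>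
    Finset.prod_ne_zero_iff.2 fun i _ => (ENNReal.ofReal_pos.2 (psi_pos _)).ne'
  have htop : ∀ v : Fin n → Space d, ∏ i, ENNReal.ofReal (psi (v i)) ≠ ∞ := fun v =>
    ENNReal.prod_ne_top fun i _ => ENNReal.ofReal_ne_top
  have h : ∀ γ : Tempered d, factorialMeasure n γ = (weightedFactorialMeasure n γ).withDensity
      (fun v => ∏ i, ENNReal.ofReal (psi (v i)))⁻¹ := fun γ =>
    (withDensity_inv_same (measurable_prod_psi n) (Filter.Eventually.of_forall hpos)
      (Filter.Eventually.of_forall htop)).symm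
  refine Measure.measurable_of_measurable_coe _ fun s hs => ?_
  simp_rw [h, withDensity_apply _ hs, ← lintegral_indicator hs]
  exact (Measure.measurable_lintegral ((measurable_prod_psi n).inv.indicator hs)).comp
    (measurable_weightedFactorialMeasure n)

/-! ### Correlation measures and product bounds -/

theorem lintegral_prod_correlationMeasure {n : ℕ} (μ : Measure (Tempered d))
    {θ : Fin n → Space d → ℝ} (hθ : ∀ i, θ i ∈ Theta d) (h0 : ∀ i x, 0 ≤ θ i x) :
    ∫⁻ v, ∏ i, ENNReal.ofReal (θ i (v i)) ∂(correlationMeasure μ n)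
      = ∫⁻ γ, ENNReal.ofReal (FHat 0 (List.ofFn θ) γ) ∂μ := by
  have hm : ∀ i, Measurable (θ i) := fun i => (hθ i).1.measurable
  rw [correlationMeasure, Measure.lintegral_bind (measurable_factorialMeasure n).aemeasurable
    (Measurable.aemeasurable (by fun_prop))]
  exact lintegral_congr fun γ => lintegral_prod_factorialMeasure θ hθ h0 γ

theorem lintegral_prod_volume {n : ℕ} {θ : Fin n → Space d → ℝ} (hθ : ∀ i, Integrable (θ i))
    (h0 : ∀ i x, 0 ≤ θ i x) :
    ∫⁻ v : Fin n → Space d, ∏ i, ENNReal.ofReal (θ i (v i)) = ENNReal.ofReal (∏ i, ∫ x, θ i x) := by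
  rw [← integral_fintype_prod_volume_eq_prod, ofReal_integral_eq_lintegral_ofReal]
  · exact lintegral_congr fun v => (ENNReal.ofReal_prod_of_nonneg fun i _ => h0 i _).symm
  · exact Integrable.fintype_prod hθ
  · exact Filter.Eventually.of_forall fun v => Finset.prod_nonneg fun i _ => h0 i _

theorem HasCorrelationBound.correlationMeasure_le {μ : Measure (Tempered d)} {ϰ : ℝ≥0}
    (h : HasCorrelationBound μ ϰ) {n : ℕ} (hn : 1 ≤ n) :
    correlationMeasure μ n ≤ ((ϰ : ℝ≥0∞) ^ n) • (volume : Measure (Fin n → Space d)) := by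
  obtain ⟨k, -, hb, he⟩ := h n hn
  rw [he, ← withDensity_const]
  refine withDensity_mono ?_
  filter_upwards [hb] with v hv
  refine (ENNReal.ofReal_le_ofReal hv.2).trans_eq ?_
  rw [ENNReal.ofReal_pow ϰ.coe_nonneg, ENNReal.ofReal_coe_nnreal]

theorem prodIntegral_ofFn {n : ℕ} (θ : Fin n → Space d → ℝ) :
    prodIntegral (List.ofFn θ) = ∏ i, ∫ x, θ i x := by
  rw [prodIntegral, List.map_ofFn, List.prod_ofFn]
  rfl

theorem HasCorrelationBound.hasProductBound {μ : Measure (Tempered d)} [IsProbabilityMeasure μ]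
    {ϰ : ℝ≥0} (h : HasCorrelationBound μ ϰ) : HasProductBound μ ϰ := by
  intro τ hτ l hne hl
  obtain ⟨n, θ, rfl⟩ : ∃ (n : ℕ) (θ : Fin n → Space d → ℝ), l = List.ofFn θ :=
    ⟨_, _, (List.ofFn_get l).symm⟩
  have hn : 1 ≤ n := by
    rcases Nat.eq_zero_or_pos n with rfl | hn
    · simp at hne
    · exact hn
  have hθ : ∀ i, θ i ∈ ThetaPlus d := fun i => hl _ (List.mem_ofFn.2 ⟨i, rfl⟩)
  have hθ1 : ∀ i, θ i ∈ Theta d := fun i => (mem_thetaPlus_iff.1 (hθ i)).1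
  have hθ0 : ∀ i x, 0 ≤ θ i x := fun i x => ((mem_thetaPlus_iff.1 (hθ i)).2 x).le
  have hl1 : ∀ θ' ∈ List.ofFn θ, θ' ∈ Theta d := fun θ h => (mem_thetaPlus_iff.1 (hl θ h)).1
  have hl0 : ∀ θ' ∈ List.ofFn θ, ∀ x, 0 ≤ θ' x :=
    fun θ h x => ((mem_thetaPlus_iff.1 (hl θ h)).2 x).le
  have hp := prodIntegral_nonneg hl
  rw [integral_eq_lintegral_of_nonneg_ae (Filter.Eventually.of_forall (FHat_nonneg hl0))
    (continuous_FHat hτ.le hl1).measurable.aestronglyMeasurable]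
  refine ENNReal.toReal_le_of_le_ofReal (by positivity) ?_
  calc ∫⁻ γ, ENNReal.ofReal (FHat τ (List.ofFn θ) γ) ∂μ
      ≤ ∫⁻ γ, ENNReal.ofReal (FHat 0 (List.ofFn θ) γ) ∂μ :=
        lintegral_mono fun γ => ENNReal.ofReal_le_ofReal (FHat_antitone le_rfl hτ.le hl1 hl0 γ)
    _ = ∫⁻ v, ∏ i, ENNReal.ofReal (θ i (v i)) ∂(correlationMeasure μ n) :=
        (lintegral_prod_correlationMeasure μ hθ1 hθ0).symm
    _ ≤ ∫⁻ v, ∏ i, ENNReal.ofReal (θ i (v i)) ∂(((ϰ : ℝ≥0∞) ^ n) • volume) :=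
        lintegral_mono' (h.correlationMeasure_le hn) le_rfl
    _ = _ := by
        rw [lintegral_smul_measure, lintegral_prod_volume
          (fun i => integrable_of_mem_theta (hθ1 i)) hθ0, prodIntegral_ofFn, List.length_ofFn,
          ENNReal.ofReal_mul (by positivity), ENNReal.ofReal_pow ϰ.coe_nonneg,
          ENNReal.ofReal_coe_nnreal, smul_eq_mul]

theorem lintegral_le_of_tendsto {α : Type*} [MeasurableSpace α] {μ : Measure α}
    {f : ℕ → α → ℝ≥0∞} {g : α → ℝ≥0∞} {c : ℝ≥0∞} (hf : ∀ k, Measurable (f k))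
    (hlim : ∀ x, Filter.Tendsto (fun k => f k x) Filter.atTop (nhds (g x)))
    (hc : ∀ k, ∫⁻ x, f k x ∂μ ≤ c) : ∫⁻ x, g x ∂μ ≤ c := by
  have h : g = fun x => Filter.liminf (fun k => f k x) Filter.atTop :=
    funext fun x => (hlim x).liminf_eq.symm
  rw [h]
  exact (lintegral_liminf_le hf).trans
    (Filter.liminf_le_of_le (by isBoundedDefault) fun b hb => by
      obtain ⟨k, hk⟩ := hb.exists
      exact hk.trans (hc k))

/-- The product bound is uniform in τ, so Fatou's lemma along τ = 1/(k + 1) carries it to τ = 0. -/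
theorem HasProductBound.lintegral_FHat_zero_le {μ : Measure (Tempered d)} [IsProbabilityMeasure μ]
    {ϰ : ℝ} (hb : HasProductBound μ ϰ) {l : List (Space d → ℝ)} (hne : l ≠ [])
    (hl : ∀ θ ∈ l, θ ∈ ThetaPlus d) :
    ∫⁻ γ, ENNReal.ofReal (FHat 0 l γ) ∂μ ≤ ENNReal.ofReal (ϰ ^ l.length * prodIntegral l) := by
  have hl1 : ∀ θ ∈ l, θ ∈ Theta d := fun θ h => (mem_thetaPlus_iff.1 (hl θ h)).1
  have hl0 : ∀ θ ∈ l, ∀ x, 0 ≤ θ x := fun θ h x => ((mem_thetaPlus_iff.1 (hl θ h)).2 x).le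
  have hΨ : Continuous fun γ : Tempered d => γ.Psi := Tempered.continuous_sum psi_mem_theta
  refine lintegral_le_of_tendsto (f := fun (k : ℕ) γ =>
    ENNReal.ofReal (FHat 0 l γ * Real.exp (-(1 / ((k : ℝ) + 1)) * γ.Psi))) (fun k => ?_)
    (fun γ => ?_) fun k => ?_
  · have := continuous_FHat (τ := 0) le_rfl hl1
    exact (Continuous.measurable (by fun_prop)).ennreal_ofReal
  · refine (ENNReal.continuous_ofReal.tendsto _).comp ?_
    have h1 := tendsto_one_div_add_atTop_nhds_zero_nat (𝕜 := ℝ)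
    have hc : Continuous fun r : ℝ => FHat 0 l γ * Real.exp (-r * γ.Psi) := by fun_prop
    simpa [Function.comp_def] using (hc.tendsto 0).comp h1
  · have hk : 0 < 1 / ((k : ℝ) + 1) := by positivity
    calc _ ≤ ∫⁻ γ, ENNReal.ofReal (FHat (1 / ((k : ℝ) + 1)) l γ) ∂μ :=
          lintegral_mono fun γ => ENNReal.ofReal_le_ofReal
            (exp_mul_FHat_zero_le hk.le hl1 hl0 γ le_rfl)
      _ = ENNReal.ofReal (∫ γ, FHat (1 / ((k : ℝ) + 1)) l γ ∂μ) :=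
          (ofReal_integral_eq_lintegral_ofReal (integrable_FHat hk hl1 μ)
            (Filter.Eventually.of_forall (FHat_nonneg hl0))).symm
      _ ≤ _ := ENNReal.ofReal_le_ofReal (hb _ hk l hne hl)

/-- Nonnegative functions become strictly positive, hence admissible, after adding εψ; then ε → 0.
-/
theorem HasProductBound.lintegral_prod_le {μ : Measure (Tempered d)} [IsProbabilityMeasure μ]
    {ϰ : ℝ} (hb : HasProductBound μ ϰ) {n : ℕ} (hn : 1 ≤ n)
    {θ : Fin n → Space d → ℝ} (hθ : ∀ i, θ i ∈ Theta d) (h0 : ∀ i x, 0 ≤ θ i x) :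
    ∫⁻ v, ∏ i, ENNReal.ofReal (θ i (v i)) ∂(correlationMeasure μ n)
      ≤ ENNReal.ofReal (ϰ ^ n * ∏ i, ∫ x, θ i x) := by
  have hε : ∀ ε : ℝ, 0 < ε → ∫⁻ v, ∏ i, ENNReal.ofReal (θ i (v i)) ∂(correlationMeasure μ n)
      ≤ ENNReal.ofReal (ϰ ^ n * ∏ i, ((∫ x, θ i x) + ε * ∫ x : Space d, psi x)) := by
    intro ε hε
    have hp : ∀ i, (fun x => θ i x + ε * psi x) ∈ ThetaPlus d := by
      intro i
      refine mem_thetaPlus_iff.2 ⟨⟨(hθ i).1.add (continuous_psi.const_mul ε), psiNorm (θ i) + ε,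
        fun x => ?_⟩, fun x => add_pos_of_nonneg_of_pos (h0 i x) (mul_pos hε (psi_pos x))⟩
      rw [abs_of_nonneg (add_nonneg (h0 i x) (mul_pos hε (psi_pos x)).le), add_mul]
      gcongr
      exact (le_abs_self _).trans (abs_le_psiNorm_mul (hθ i) x)
    have hl : ∀ θ' ∈ List.ofFn (fun i x => θ i x + ε * psi x), θ' ∈ ThetaPlus d := by
      intro θ' h
      obtain ⟨i, rfl⟩ := List.mem_ofFn.1 h
      exact hp i
    calc _ ≤ ∫⁻ v, ∏ i, ENNReal.ofReal (θ i (v i) + ε * psi (v i)) ∂(correlationMeasure μ n) := by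
          refine lintegral_mono fun v => Finset.prod_le_prod' fun i _ => ENNReal.ofReal_le_ofReal ?_
          exact le_add_of_nonneg_right (mul_pos hε (psi_pos _)).le
      _ = ∫⁻ γ, ENNReal.ofReal (FHat 0 (List.ofFn fun i x => θ i x + ε * psi x) γ) ∂μ :=
          lintegral_prod_correlationMeasure (θ := fun i x => θ i x + ε * psi x) μ
            (fun i => (mem_thetaPlus_iff.1 (hp i)).1)
            fun i x => ((mem_thetaPlus_iff.1 (hp i)).2 x).le
      _ ≤ _ := hb.lintegral_FHat_zero_le (by simp; omega) hl
      _ = _ := by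
          rw [List.length_ofFn, prodIntegral_ofFn]
          congr 2
          refine Finset.prod_congr rfl fun i _ => ?_
          rw [integral_add (integrable_of_mem_theta (hθ i)) (integrable_psi.const_mul ε),
            integral_const_mul]
  have hc : Continuous fun ε : ℝ =>
      ENNReal.ofReal (ϰ ^ n * ∏ i, ((∫ x, θ i x) + ε * ∫ x : Space d, psi x)) :=
    ENNReal.continuous_ofReal.comp (by fun_prop)
  have hlim := (hc.tendsto 0).mono_left (nhdsWithin_le_nhds (s := Ioi 0))
  simp only [zero_mul, add_zero] at hlim
  refine ge_of_tendsto hlim ?_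
  filter_upwards [self_mem_nhdsWithin] with ε h
  exact hε ε h

/-! ### From product bounds to correlation functions -/

theorem openApprox_mem_theta {U : Set (Space d)} (hU : IsOpen U) {R : ℝ} (hR0 : 0 ≤ R)
    (hR : U ⊆ Metric.ball 0 R) (k : ℕ) : openApprox hU k ∈ Theta d := by
  refine ⟨continuous_openApprox hU k, 1 + R ^ (d + 1), fun x => ?_⟩
  rw [abs_of_nonneg (openApprox_nonneg hU k x)]
  by_cases hx : x ∈ U
  · have h1 : ‖x‖ < R := by simpa using hR hx
    refine (openApprox_le_one hU k x).trans ?_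
    rw [psi, mul_one_div, one_le_div (by positivity)]
    gcongr
  · rw [openApprox_eq_zero hU k hx]
    exact mul_nonneg (by positivity) (psi_pos x).le

section

variable {μ : Measure (Tempered d)} [IsProbabilityMeasure μ] {ϰ : ℝ≥0} {n : ℕ}

theorem HasProductBound.openBox_le (hb : HasProductBound μ ϰ) (hn : 1 ≤ n)
    {U : Fin n → Set (Space d)} (hU : ∀ i, IsOpen (U i)) {R : ℝ} (hR0 : 0 ≤ R)
    (hR : ∀ i, U i ⊆ Metric.ball 0 R) :
    correlationMeasure μ n (univ.pi U) ≤ (ϰ : ℝ≥0∞) ^ n * ∏ i, volume (U i) := by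
  rw [← lintegral_indicator_one (MeasurableSet.univ_pi fun i => (hU i).measurableSet)]
  have hm : ∀ k i, Measurable (openApprox (hU i) k) :=
    fun k i => (continuous_openApprox (hU i) k).measurable
  have hm' : ∀ k, Measurable fun v : Fin n → Space d =>
      ∏ i, ENNReal.ofReal (openApprox (hU i) k (v i)) := fun k =>
    Finset.measurable_fun_prod _ fun i _ => ((hm k i).comp (measurable_pi_apply i)).ennreal_ofReal
  refine lintegral_le_of_tendsto hm' (tendsto_prod_openApprox hU) fun k => ?_
  have hθ : ∀ i, openApprox (hU i) k ∈ Theta d := fun i => openApprox_mem_theta (hU i) hR0 (hR i) k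
  have h0 := fun i => openApprox_nonneg (hU i) k
  refine (hb.lintegral_prod_le hn hθ h0).trans ?_
  rw [ENNReal.ofReal_mul (pow_nonneg ϰ.coe_nonneg n), ENNReal.ofReal_pow ϰ.coe_nonneg,
    ENNReal.ofReal_coe_nnreal, ENNReal.ofReal_prod_of_nonneg fun i _ => integral_nonneg (h0 i)]
  refine mul_le_mul_right (Finset.prod_le_prod' fun i _ => ?_) _
  rw [ofReal_integral_eq_lintegral_ofReal (integrable_of_mem_theta (hθ i))
    (Filter.Eventually.of_forall (h0 i)), ← lintegral_indicator_one (hU i).measurableSet]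
  refine lintegral_mono fun x => ?_
  by_cases hx : x ∈ U i
  · simpa [hx] using openApprox_le_one (hU i) k x
  · simp [openApprox_eq_zero (hU i) k hx]

/-- Outer regularity of Lebesgue measure reduces to open boxes. The sides need not be measurable, as
the comparison of outer measures requires; boundedness keeps the volumes finite, so that the product
converges as ε → 0. -/
theorem HasProductBound.boundedBox_le (hb : HasProductBound μ ϰ) (hn : 1 ≤ n)
    {S : Fin n → Set (Space d)} {R : ℝ} (hR0 : 0 ≤ R) (hR : ∀ i, S i ⊆ Metric.ball 0 R) :
    correlationMeasure μ n (univ.pi S) ≤ (ϰ : ℝ≥0∞) ^ n * ∏ i, volume (S i) := by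
  have hfin : ∀ i, volume (S i) ≠ ∞ := fun i =>
    ((measure_mono (hR i)).trans_lt measure_ball_lt_top).ne
  have hε : ∀ ε : ℝ≥0∞, ε ≠ 0 → correlationMeasure μ n (univ.pi S)
      ≤ (ϰ : ℝ≥0∞) ^ n * ∏ i, (volume (S i) + ε) := by
    intro ε hε
    choose V hSV hV hVε using fun i => (S i).exists_isOpen_le_add volume hε
    calc correlationMeasure μ n (univ.pi S)
        ≤ correlationMeasure μ n (univ.pi fun i => V i ∩ Metric.ball 0 R) :=
          measure_mono (pi_mono fun i _ => subset_inter (hSV i) (hR i))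
      _ ≤ _ := hb.openBox_le hn (fun i => (hV i).inter Metric.isOpen_ball) hR0
          fun i => inter_subset_right
      _ ≤ _ := by
          gcongr with i
          exact (measure_mono inter_subset_left).trans (hVε i)
  have hlim : Filter.Tendsto (fun ε : ℝ≥0∞ => (ϰ : ℝ≥0∞) ^ n * ∏ i, (volume (S i) + ε))
      (nhdsWithin 0 (Ioi 0)) (nhds ((ϰ : ℝ≥0∞) ^ n * ∏ i, volume (S i))) := by
    refine ENNReal.Tendsto.const_mul ?_ (Or.inr (by finiteness))
    refine ENNReal.tendsto_finsetProd_of_ne_top _ (fun i _ => ?_) fun i _ => hfin i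
    have : Continuous fun ε : ℝ≥0∞ => volume (S i) + ε := by fun_prop
    simpa using (this.tendsto 0).mono_left nhdsWithin_le_nhds
  refine ge_of_tendsto hlim ?_
  filter_upwards [self_mem_nhdsWithin] with ε h
  exact hε ε (ne_of_gt h)

theorem HasProductBound.box_le (hb : HasProductBound μ ϰ) (hn : 1 ≤ n)
    (S : Fin n → Set (Space d)) :
    correlationMeasure μ n (univ.pi S) ≤ (ϰ : ℝ≥0∞) ^ n * ∏ i, volume (S i) := by
  have hmono : Monotone fun k : ℕ => univ.pi fun i => S i ∩ Metric.ball 0 (k : ℝ) :=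
    fun k k' h => pi_mono fun i _ => inter_subset_inter_right _
      (Metric.ball_subset_ball (Nat.cast_le.2 h))
  have hU : univ.pi S = ⋃ k : ℕ, univ.pi fun i => S i ∩ Metric.ball 0 (k : ℝ) := by
    ext v
    simp only [mem_pi, mem_univ, forall_true_left, mem_iUnion, mem_inter_iff, mem_ball_zero_iff]
    refine ⟨fun h => ?_, fun ⟨k, hk⟩ i => (hk i).1⟩
    obtain ⟨k, hk⟩ := exists_nat_gt ‖v‖
    exact ⟨k, fun i => ⟨h i, (norm_le_pi_norm v i).trans_lt hk⟩⟩
  rw [hU, hmono.measure_iUnion]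
  refine iSup_le fun k => (hb.boundedBox_le hn (Nat.cast_nonneg k)
    fun i => inter_subset_right).trans ?_
  gcongr
  exact inter_subset_left

/-- Lebesgue measure on the product comes from the largest outer measure that is at most the product
of volumes on boxes. Dividing χ^(n) by ϰ^n therefore reduces the claim for all measurable sets to
boxes. -/
theorem HasProductBound.correlationMeasure_le (hb : HasProductBound μ ϰ) (hϰ : 0 < ϰ)
    (hn : 1 ≤ n) :
    correlationMeasure μ n ≤ ((ϰ ^ n : ℝ≥0) : ℝ≥0∞) • (volume : Measure (Fin n → Space d)) := by
  have hc : ((ϰ ^ n : ℝ≥0) : ℝ≥0∞) ≠ 0 := by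
    rw [ENNReal.coe_ne_zero]; positivity
  have hc' : ((ϰ ^ n : ℝ≥0) : ℝ≥0∞) ≠ ∞ := ENNReal.coe_ne_top
  have h1 : (((ϰ ^ n : ℝ≥0) : ℝ≥0∞)⁻¹ • correlationMeasure μ n).toOuterMeasure ≤
      OuterMeasure.pi fun _ => (volume : Measure (Space d)).toOuterMeasure := by
    rw [OuterMeasure.le_pi]
    intro S _
    have := hb.box_le hn S
    change ((ϰ ^ n : ℝ≥0) : ℝ≥0∞)⁻¹ * correlationMeasure μ n (univ.pi S) ≤ _
    rw [mul_comm, ← div_eq_mul_inv, ENNReal.div_le_iff hc hc', mul_comm]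
    push_cast
    exact this
  refine Measure.le_iff.2 fun A hA => ?_
  have h2 : (((ϰ ^ n : ℝ≥0) : ℝ≥0∞)⁻¹ • correlationMeasure μ n) A ≤ volume A := by
    rw [volume_pi, Measure.pi_def]
    exact (h1 A).trans (le_toMeasure_apply _ _ _)
  rw [Measure.smul_apply, smul_eq_mul, mul_comm, ← div_eq_mul_inv, ENNReal.div_le_iff hc hc',
    mul_comm] at h2
  exact h2

theorem HasProductBound.hasCorrelationBound (hb : HasProductBound μ ϰ) (hϰ : 0 < ϰ) :
    HasCorrelationBound μ ϰ := by
  intro n hn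
  set ν := correlationMeasure μ n
  have hle : ν ≤ ((ϰ ^ n : ℝ≥0) : ℝ≥0∞) • (volume : Measure (Fin n → Space d)) :=
    hb.correlationMeasure_le hϰ hn
  have hσ' : SigmaFinite (((ϰ ^ n : ℝ≥0) : ℝ≥0∞) • (volume : Measure (Fin n → Space d))) :=
    inferInstanceAs (SigmaFinite ((ϰ ^ n : ℝ≥0) • (volume : Measure (Fin n → Space d))))
  have hσ : SigmaFinite ν := Measure.sigmaFinite_of_le _ hle
  have hac : ν ≪ volume :=
    (Measure.absolutelyContinuous_of_le hle).trans Measure.smul_absolutelyContinuous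
  have hd : (volume : Measure (Fin n → Space d)).withDensity (ν.rnDeriv volume) = ν :=
    Measure.withDensity_rnDeriv_eq _ _ hac
  have hae : ∀ᵐ v, ν.rnDeriv volume v ≤ ((ϰ ^ n : ℝ≥0) : ℝ≥0∞) := by
    refine ae_le_of_forall_setLIntegral_le_of_sigmaFinite (Measure.measurable_rnDeriv _ _)
      fun s hs _ => ?_
    rw [← withDensity_apply _ hs, hd, lintegral_const, Measure.restrict_apply_univ]
    exact hle s
  refine ⟨fun v => (ν.rnDeriv volume v).toReal, (Measure.measurable_rnDeriv _ _).ennreal_toReal,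
    ?_, ?_⟩
  · filter_upwards [hae] with v hv
    exact ⟨ENNReal.toReal_nonneg, by simpa using ENNReal.toReal_mono ENNReal.coe_ne_top hv⟩
  · rw [← hd]
    refine withDensity_congr_ae ?_
    filter_upwards [hae] with v hv
    rw [hd, ENNReal.ofReal_toReal (hv.trans_lt ENNReal.coe_lt_top).ne]

theorem HasProductBound.hasFiniteCorrelations (hb : HasProductBound μ ϰ) (hϰ : 0 < ϰ) :
    HasFiniteCorrelations μ := by
  intro n Λ hΛ
  -- The product bound says nothing about n = 0, where the correlation measure is a Dirac mass.
  rcases Nat.eq_zero_or_pos n with rfl | hn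
  · have : correlationMeasure μ 0 = Measure.dirac Fin.elim0 := by
      have h : factorialMeasure (d := d) 0 = fun _ => Measure.dirac Fin.elim0 := rfl
      rw [correlationMeasure, h, Measure.bind_const, measure_univ, one_smul]
    rw [this]
    exact measure_lt_top _ _
  · refine (hb.correlationMeasure_le hϰ hn _).trans_lt ?_
    exact ENNReal.mul_lt_top ENNReal.coe_lt_top (isCompact_univ_pi fun _ => hΛ).measure_lt_top

theorem HasProductBound.integral_prod_le (hb : HasProductBound μ ϰ) (hϰ : 0 < ϰ)
    {θ : Space d → ℝ} (hθ : Continuous θ) (hc : HasCompactSupport θ) (hn : 1 ≤ n) :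
    ∫ v, (∏ i, θ (v i)) ∂(correlationMeasure μ n) ≤ (ϰ : ℝ) ^ n * (∫ x, |θ x|) ^ n := by
  have hi : Integrable fun x => |θ x| := (hθ.integrable_of_hasCompactSupport hc).abs
  have h1 : ∫⁻ v, ENNReal.ofReal ‖∏ i, θ (v i)‖ ∂(correlationMeasure μ n)
      ≤ ENNReal.ofReal ((ϰ : ℝ) ^ n * (∫ x, |θ x|) ^ n) := by
    calc ∫⁻ v, ENNReal.ofReal ‖∏ i, θ (v i)‖ ∂(correlationMeasure μ n)
        = ∫⁻ v, ∏ i, ENNReal.ofReal |θ (v i)| ∂(correlationMeasure μ n) := by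
          refine lintegral_congr fun v => ?_
          rw [norm_prod, ENNReal.ofReal_prod_of_nonneg fun i _ => norm_nonneg _]
          rfl
      _ ≤ ∫⁻ v, ∏ i, ENNReal.ofReal |θ (v i)| ∂(((ϰ ^ n : ℝ≥0) : ℝ≥0∞) • volume) :=
          lintegral_mono' (hb.correlationMeasure_le hϰ hn) le_rfl
      _ = _ := by
          rw [lintegral_smul_measure, lintegral_prod_volume (θ := fun _ x => |θ x|) (fun _ => hi)
            fun _ x => abs_nonneg _, Finset.prod_const, Finset.card_univ, Fintype.card_fin,
            ENNReal.ofReal_mul (by positivity), smul_eq_mul]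
          congr 1
          rw [← NNReal.coe_pow, ENNReal.ofReal_coe_nnreal]
  refine (Real.le_norm_self _).trans ((norm_integral_le_lintegral_norm _).trans ?_)
  refine ENNReal.toReal_le_of_le_ofReal ?_ h1
  have : 0 ≤ ∫ x, |θ x| := integral_nonneg fun x => abs_nonneg _
  positivity

theorem HasProductBound.mem_PexpLE {ϑ : ℝ} (hb : HasProductBound μ (Real.exp ϑ)) :
    μ ∈ PexpLE d ϑ := by
  have hϰ : 0 < (⟨Real.exp ϑ, (Real.exp_pos ϑ).le⟩ : ℝ≥0) := Real.exp_pos ϑ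
  have hb' : HasProductBound μ (⟨Real.exp ϑ, (Real.exp_pos ϑ).le⟩ : ℝ≥0) := hb
  refine ⟨⟨inferInstance, hb'.hasFiniteCorrelations hϰ, Real.exp ϑ, Real.exp_pos ϑ,
    fun θ hθ hc n hn => hb'.integral_prod_le hϰ hθ hc hn⟩, ?_⟩
  refine (iInf₂_le _ (hb'.hasCorrelationBound hϰ)).trans_eq ?_
  rw [ENNReal.ofReal_eq_coe_nnreal (Real.exp_pos ϑ).le]
  rfl

/-- The type is an infimum; the strict gap between ϑ and ϑ' provides an actual correlation bound
below e^{ϑ'} without showing that the infimum is attained. -/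
theorem HasProductBound.of_mem_PexpLE {ϑ ϑ' : ℝ} (hμ : μ ∈ PexpLE d ϑ) (h : ϑ < ϑ') :
    HasProductBound μ (Real.exp ϑ') := by
  have hlt : measureType μ < ENNReal.ofReal (Real.exp ϑ') :=
    hμ.2.trans_lt ((ENNReal.ofReal_lt_ofReal_iff (Real.exp_pos _)).2 (Real.exp_lt_exp.2 h))
  obtain ⟨κ, hκ⟩ := iInf_lt_iff.1 hlt
  obtain ⟨hb, hκ'⟩ := iInf_lt_iff.1 hκ
  have hle : (κ : ℝ) ≤ Real.exp ϑ' := by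
    have h1 := ENNReal.toReal_mono ENNReal.ofReal_ne_top hκ'.le
    rwa [ENNReal.coe_toReal, ENNReal.toReal_ofReal (Real.exp_pos _).le] at h1
  intro τ hτ l hne hl
  refine (hb.hasProductBound τ hτ l hne hl).trans ?_
  have := prodIntegral_nonneg hl
  gcongr

end

end

end Kawasaki

/-! ### The main theorem -/

theorem mainTheorem3 (d : ℕ) (hd : 0 < d) (a φ : Kawasaki.Space d → ℝ)
    (hmodel : Kawasaki.ModelConditions a φ) (ϑ₀ T : ℝ) (hT : 0 < T) :
    ∃ ϑT : ℝ, ∀ μ : ℝ → MeasureTheory.Measure (Kawasaki.Tempered d),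
      Kawasaki.SolvesFokkerPlanck a φ
        (Submodule.span ℝ (Kawasaki.FHatSet d) : Set (Kawasaki.Tempered d → ℝ)) μ →
      μ 0 ∈ Kawasaki.PexpLE d ϑ₀ →
      ∀ t ∈ Set.Icc (0 : ℝ) T, ∃ ϑt : ℝ, ϑt < ϑT ∧ μ t ∈ Kawasaki.PexpLE d ϑt := by
  -- The growth factor e^t adds t to the exponent. One unit is spent on passing from the type to a
  -- product bound at time 0, another on the strict inequality at t = T.
  refine ⟨ϑ₀ + T + 2, fun μ hμ h0 t ht => ⟨ϑ₀ + 1 + t, by linarith [ht.2], ?_⟩⟩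
  have := hμ.isProbabilityMeasure 0 le_rfl
  have := hμ.isProbabilityMeasure t ht.1
  have hb := Kawasaki.HasProductBound.of_solves hmodel hμ (Real.exp_pos (ϑ₀ + 1)).le
    (Kawasaki.HasProductBound.of_mem_PexpLE h0 (lt_add_one ϑ₀)) ht.1
  rw [← Real.exp_add] at hb
  exact hb.mem_PexpLE
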